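/- A group is \emph{polycyclic} if it has a finite series $1=G_0\triangleleft G_1\triangleleft\cdots\triangleleft G_r=G$ (each term normal in the next) with cyclic factors $G_i/G_{i-1}$. A group is called \emph{minimax} (more precisely, elementary amenable minimax) if it has a finite series $1=G_0\triangleleft G_1\triangleleft\cdots\triangleleft G_r=G$ in which every factor $G_i/G_{i-1}$ is cyclic, quasicyclic (that is, isomorphic to the Prüfer group $C_{p^\infty}$ for some prime $p$), or finite. Let $G$ be a minimax group and let $K$ be a normal subgroup of $G$ such that $G/K$ is polycyclic. Then $G$ has a polycyclic subgroup $H$ such that the subgroup $HK=\{hk : h\in H,\ k\in K\}$ has finite index in $G$. -/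

import Mathlib

/-- `G` has a finite series `1 = S 0 ◁ S 1 ◁ ⋯ ◁ S r = G` (each term normal in the next one)
all of whose factors `S (i + 1) / S i` satisfy `P`. -/
def HasSubnormalSeries.{u} (P : ∀ (Q : Type u) [Group Q], Prop) (G : Type u) [Group G] : Prop :=
  ∃ (r : ℕ) (S : ℕ → Subgroup G), S 0 = ⊥ ∧ S r = ⊤ ∧
    ∀ i < r, S i ≤ S (i + 1) ∧
      ∃ _ : ((S i).subgroupOf (S (i + 1))).Normal, P (S (i + 1) ⧸ (S i).subgroupOf (S (i + 1)))

/-- A polycyclic group: there is a finite subnormal series with cyclic factors. -/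
def IsPolycyclic.{u} (G : Type u) [Group G] : Prop :=
  HasSubnormalSeries (fun (Q : Type u) [Group Q] => IsCyclic Q) G

/-- A quasicyclic (Prüfer) group: for some prime `p` it is isomorphic to `C_{p^∞}`, realised
here as the group of all complex roots of unity of `p`-power order. -/
def IsQuasicyclic.{u} (Q : Type u) [Group Q] : Prop :=
  ∃ (p : ℕ) (_ : Fact p.Prime), Nonempty (Q ≃* CommGroup.primaryComponent ℂˣ p)

/-- A minimax (more precisely, elementary amenable minimax) group: there is a finite subnormal
series in which each factor is cyclic, quasicyclic or finite. -/
def IsMinimax.{u} (G : Type u) [Group G] : Prop :=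
  HasSubnormalSeries
    (fun (Q : Type u) [Group Q] => IsCyclic Q ∨ IsQuasicyclic Q ∨ Finite Q) G

open scoped commutatorElement

/-! Only two properties of a minimax group are needed: its abelian sections of finite exponent are
finite (`FiniteAbelianTorsionSections`), and it is virtually solvable. Unlike the existence of a
minimax series, the first passes at once to subgroups and quotients, so it is what the reductions
carry along. Near supplements can be found in two stages (`trans`), first for `K / B` and then for
`B`. By induction on derived length this reduces to `K = A` abelian, and then to `A` torsion or
torsion-free. Since polycyclic groups are finitely presented, a finitely generated supplement `S` of
`A` meets `A` in the normal closure of a finite set. If `A` is torsion, this intersection has finite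
exponent, so it is finite and `S` is polycyclic. If `A` is torsion-free, `Hom(A, ℂ)` is
finite-dimensional and `G / A` acts on it. A subgroup of finite index has a common eigenvector,
whose kernel `B` has a smaller dual. So one may assume that `A` lies in a field of characteristic
zero and that `G` acts on it by scalars `χ`. If all `χ g` are integral and `G` is finitely
generated, `A` is finitely generated and `G` is polycyclic. If some `χ x` is not integral,
Cayley-Hamilton on the abelianization of `ker χ` gives a derivation `δ` from `G` to `A` that is
multiplication by a nonzero scalar on `A`. The kernel of `δ` meets `A` trivially, and `δ(A)` has
finite index in `A`, so the kernel is a near supplement. -/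

theorem HasSubnormalSeries.induction.{u} {P R : ∀ (Q : Type u) [Group Q], Prop}
    (htriv : ∀ (G : Type u) [Group G] [Subsingleton G], R G)
    (hiso : ∀ (G H : Type u) [Group G] [Group H], (G ≃* H) → R G → R H)
    (hext : ∀ (G : Type u) [Group G] (N : Subgroup G) [N.Normal], R N → P (G ⧸ N) → R G)
    {G : Type u} [Group G] (h : HasSubnormalSeries P G) : R G := by
  obtain ⟨r, S, h0, hr, hS⟩ := h
  have key : ∀ i ≤ r, R (S i) := by
    intro i
    induction i with
    | zero =>
      intro _
      rw [h0]
      exact htriv _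
    | succ i ih =>
      intro hi
      obtain ⟨hle, hn, hP⟩ := hS i hi
      exact hext _ _ (hiso _ _ (Subgroup.subgroupOfEquivOfLe hle).symm (ih (by omega))) hP
  have := key r le_rfl
  rw [hr] at this
  exact hiso _ _ Subgroup.topEquiv this

theorem QuotientGroup.map_comap_injective {G H : Type*} [Group G] [Group H] (f : H →* G)
    (N : Subgroup G) [N.Normal] :
    Function.Injective (QuotientGroup.map (N.comap f) N f le_rfl) := by
  refine (injective_iff_map_eq_one _).2 fun x hx => ?_
  induction x using QuotientGroup.induction_on with
  | H x =>
    rw [QuotientGroup.map_mk, QuotientGroup.eq_one_iff] at hx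
    exact (QuotientGroup.eq_one_iff _).2 hx

/-! ### Closure properties of polycyclic groups -/

namespace IsPolycyclic

theorem of_subsingleton (G : Type*) [Group G] [Subsingleton G] : IsPolycyclic G :=
  ⟨0, fun _ => ⊥, rfl, Subsingleton.elim _ _, fun i hi => absurd hi (Nat.not_lt_zero i)⟩

theorem of_cyclic_quotient {G : Type*} [Group G] (N : Subgroup G) [hN : N.Normal]
    (h : IsPolycyclic N) (hc : IsCyclic (G ⧸ N)) : IsPolycyclic G := by
  obtain ⟨r, S, h0, hr, hS⟩ := h
  -- The series of `N`, pushed into `G`, followed by one more term `⊤` at index `r + 1`.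
  obtain ⟨T, hT, hT'⟩ : ∃ T : ℕ → Subgroup G, (∀ i ≤ r, T i = (S i).map N.subtype) ∧
      T (r + 1) = ⊤ :=
    ⟨fun i => if i ≤ r then (S i).map N.subtype else ⊤, fun i hi => if_pos hi, by simp⟩
  refine ⟨r + 1, T, ?_, hT', ?_⟩
  · rw [hT 0 (Nat.zero_le r), h0, Subgroup.map_bot]
  · intro i hi
    rcases Nat.lt_succ_iff_lt_or_eq.mp hi with hi | rfl
    · obtain ⟨hle, hn, hc⟩ := hS i hi
      rw [hT i hi.le, hT (i + 1) hi]
      let f : S (i + 1) →* (S (i + 1)).map N.subtype := N.subtype.subgroupMap (S (i + 1))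
      have hf : Function.Surjective f := N.subtype.subgroupMap_surjective (S (i + 1))
      have hfi : Function.Injective f := by
        intro a b hab
        have := congrArg Subtype.val hab
        exact Subtype.ext (Subtype.ext this)
      have hmap : ((S i).subgroupOf (S (i + 1))).map f =
          ((S i).map N.subtype).subgroupOf ((S (i + 1)).map N.subtype) := by
        ext x
        obtain ⟨y, rfl⟩ := hf x
        rw [Subgroup.mem_map_iff_mem hfi, Subgroup.mem_subgroupOf, Subgroup.mem_subgroupOf]
        exact (Subgroup.mem_map_iff_mem N.subtype_injective).symm
      refine ⟨Subgroup.map_mono hle, ?_⟩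
      rw [← hmap]
      have hn' : (((S i).subgroupOf (S (i + 1))).map f).Normal := hn.map f hf
      refine ⟨hn', ?_⟩
      exact isCyclic_of_surjective
        (QuotientGroup.map _ (((S i).subgroupOf (S (i + 1))).map f) f (Subgroup.le_comap_map _ _))
        (QuotientGroup.map_surjective_of_surjective _ _ _
          ((QuotientGroup.mk'_surjective _).comp hf) _)
    · have e : (S i).map N.subtype = N := by
        rw [hr, ← MonoidHom.range_eq_map, Subgroup.range_subtype]
      rw [hT i le_rfl, hT', e]
      refine ⟨le_top, inferInstance, ?_⟩
      exact isCyclic_of_injective _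
        (QuotientGroup.map_comap_injective (Subgroup.subtype (⊤ : Subgroup G)) N)

theorem of_surjective.{u} {G H : Type u} [Group G] [Group H] (hG : IsPolycyclic G) (f : G →* H)
    (hf : Function.Surjective f) : IsPolycyclic H := by
  refine HasSubnormalSeries.induction
    (R := fun G _ => ∀ (H : Type u) [Group H] (f : G →* H), Function.Surjective f → IsPolycyclic H)
    ?_ ?_ ?_ hG H f hf
  · intro G _ _ H _ f hf
    have : Subsingleton H := hf.subsingleton
    exact of_subsingleton H
  · intro G G' _ _ e h H _ f hf
    exact h H (f.comp e.toMonoidHom) (hf.comp e.surjective)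
  · intro G _ N hN ih hc H _ f hf
    have : (N.map f).Normal := hN.map f hf
    exact of_cyclic_quotient (N.map f) (ih _ _ (f.subgroupMap_surjective N))
      (isCyclic_of_surjective (QuotientGroup.map N (N.map f) f (Subgroup.le_comap_map _ _))
        (QuotientGroup.map_surjective_of_surjective _ _ _
          ((QuotientGroup.mk'_surjective _).comp hf) _))

theorem of_mulEquiv.{u} {G H : Type u} [Group G] [Group H] (hG : IsPolycyclic G) (e : G ≃* H) :
    IsPolycyclic H := hG.of_surjective e.toMonoidHom e.surjective

theorem induction.{u} {R : ∀ (Q : Type u) [Group Q], Prop}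
    (htriv : ∀ (G : Type u) [Group G] [Subsingleton G], R G)
    (hiso : ∀ (G H : Type u) [Group G] [Group H], (G ≃* H) → R G → R H)
    (hext : ∀ (G : Type u) [Group G] (N : Subgroup G) [N.Normal], IsPolycyclic N → R N →
      IsCyclic (G ⧸ N) → R G)
    {G : Type u} [Group G] (h : IsPolycyclic G) : R G :=
  (HasSubnormalSeries.induction (R := fun G _ => IsPolycyclic G ∧ R G)
    (fun G _ _ => ⟨of_subsingleton G, htriv G⟩)
    (fun G H _ _ e h => ⟨h.1.of_mulEquiv e, hiso G H e h.2⟩)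
    (fun G _ N _ h hc => ⟨of_cyclic_quotient N h.1 hc, hext G N h.1 h.2 hc⟩) h).2

theorem of_injective.{u} {G H : Type u} [Group G] [Group H] (hG : IsPolycyclic G) (f : H →* G)
    (hf : Function.Injective f) : IsPolycyclic H := by
  refine HasSubnormalSeries.induction
    (R := fun G _ => ∀ (H : Type u) [Group H] (f : H →* G), Function.Injective f → IsPolycyclic H)
    ?_ ?_ ?_ hG H f hf
  · intro G _ _ H _ f hf
    have : Subsingleton H := hf.subsingleton
    exact of_subsingleton H
  · intro G G' _ _ e h H _ f hf
    exact h H (e.symm.toMonoidHom.comp f) (e.symm.injective.comp hf)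
  · intro G _ N hN ih hc H _ f hf
    refine of_cyclic_quotient (N.comap f) (ih _ (f.subgroupComap N) ?_)
      (isCyclic_of_injective _ (QuotientGroup.map_comap_injective f N))
    · intro a b hab
      exact Subtype.ext (hf (congrArg Subtype.val hab))

theorem subgroup {G : Type*} [Group G] (hG : IsPolycyclic G) (H : Subgroup G) : IsPolycyclic H :=
  hG.of_injective H.subtype H.subtype_injective

theorem of_ker.{u} {G Q : Type u} [Group G] [Group Q] (f : G →* Q) (hf : Function.Surjective f)
    (hk : IsPolycyclic f.ker) (hQ : IsPolycyclic Q) : IsPolycyclic G := by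
  refine induction
    (R := fun Q _ => ∀ (G : Type u) [Group G] (f : G →* Q), Function.Surjective f →
      IsPolycyclic f.ker → IsPolycyclic G)
    ?_ ?_ ?_ hQ G f hf hk
  · intro Q _ _ G _ f _ hk
    have : f.ker = ⊤ := by ext; simp [MonoidHom.mem_ker, Subsingleton.elim _ (1 : Q)]
    rw [this] at hk
    exact hk.of_mulEquiv Subgroup.topEquiv
  · intro Q Q' _ _ e h G _ f hf hk
    refine h G (e.symm.toMonoidHom.comp f) (e.symm.surjective.comp hf) ?_
    have : (e.symm.toMonoidHom.comp f).ker = f.ker := by ext; simp [MonoidHom.mem_ker]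
    rwa [this]
  · intro Q _ N hN _ ih hc G _ f hf hk
    refine of_cyclic_quotient (N.comap f) (ih _ (f.subgroupComap N) ?_ ?_)
      (isCyclic_of_injective _ (QuotientGroup.map_comap_injective f N))
    · exact f.subgroupComap_surjective_of_surjective N hf
    · refine hk.of_injective
        (((N.comap f).subtype.comp (f.subgroupComap N).ker.subtype).codRestrict _ ?_) ?_
      · intro x
        exact congrArg Subtype.val x.2
      · intro a b hab
        exact Subtype.ext (Subtype.ext (congrArg (fun z : f.ker => (z : G)) hab))

theorem of_normal {G : Type*} [Group G] (N : Subgroup G) [N.Normal] (hN : IsPolycyclic N)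
    (hQ : IsPolycyclic (G ⧸ N)) : IsPolycyclic G :=
  of_ker (QuotientGroup.mk' N) (QuotientGroup.mk'_surjective N)
    (by rwa [QuotientGroup.ker_mk']) hQ

theorem closure_finset {G : Type*} [CommGroup G] (s : Finset G) :
    IsPolycyclic (Subgroup.closure (s : Set G)) := by
  classical
  induction s using Finset.induction_on with
  | empty =>
    rw [Finset.coe_empty, Subgroup.closure_empty]
    exact of_subsingleton _
  | insert a s _ ih =>
    rw [Finset.coe_insert, Set.insert_eq, Subgroup.closure_union, sup_comm]
    set S := Subgroup.closure (s : Set G)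
    set Z := Subgroup.closure ({a} : Set G)
    let N : Subgroup ↥(S ⊔ Z) := S.subgroupOf (S ⊔ Z)
    refine of_cyclic_quotient N
      (ih.of_mulEquiv (Subgroup.subgroupOfEquivOfLe le_sup_left).symm) ?_
    have haZ : a ∈ Z := Subgroup.subset_closure rfl
    refine ⟨⟨QuotientGroup.mk ⟨a, Subgroup.mem_sup_right haZ⟩, fun x => ?_⟩⟩
    induction x using QuotientGroup.induction_on with
    | H x =>
      obtain ⟨x, hx⟩ := x
      obtain ⟨y, hy, z, hz, rfl⟩ := Subgroup.mem_sup.1 hx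
      obtain ⟨k, rfl⟩ := Subgroup.mem_closure_singleton.1 hz
      refine ⟨k, ?_⟩
      change ((_ : ↥(S ⊔ Z) ⧸ N)) ^ k = _
      rw [← QuotientGroup.mk_zpow, eq_comm, QuotientGroup.eq, Subgroup.mem_subgroupOf]
      simpa [mul_comm] using hy

theorem of_comm_fg {G : Type*} [Group G] (hc : ∀ a b : G, a * b = b * a) (hfg : Group.FG G) :
    IsPolycyclic G := by
  let _ : CommGroup G := { ‹Group G› with mul_comm := hc }
  obtain ⟨s, hs⟩ := Group.fg_def.1 hfg
  have := closure_finset s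
  rw [hs] at this
  exact this.of_mulEquiv Subgroup.topEquiv

/-- A surjection onto a cyclic quotient: some element generates `G` modulo `N`. -/
theorem _root_.exists_zpow_mul_mem {G : Type*} [Group G] (N : Subgroup G) [N.Normal]
    (hc : IsCyclic (G ⧸ N)) : ∃ t : G, ∀ g : G, ∃ k : ℤ, g * t ^ (-k) ∈ N := by
  obtain ⟨t, ht⟩ := hc.exists_generator
  obtain ⟨t, rfl⟩ := QuotientGroup.mk_surjective t
  refine ⟨t, fun g => ?_⟩
  obtain ⟨k, hk⟩ := ht g
  refine ⟨k, ?_⟩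
  rw [← QuotientGroup.eq_one_iff, QuotientGroup.mk_mul, QuotientGroup.mk_zpow, ← hk]
  simp

theorem fg {G : Type*} [Group G] (hG : IsPolycyclic G) : Group.FG G := by
  refine HasSubnormalSeries.induction (R := fun G _ => Group.FG G) ?_ ?_ ?_ hG
  · intro G _ _
    infer_instance
  · intro G H _ _ e h
    exact Group.fg_of_surjective (f := e.toMonoidHom) e.surjective
  · intro G _ N _ h hc
    obtain ⟨t, ht⟩ := exists_zpow_mul_mem N hc
    obtain ⟨S, hS, hfin⟩ := (Subgroup.fg_iff N).1 ((Group.fg_iff_subgroup_fg N).1 h)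
    refine Group.fg_iff.2 ⟨insert t S, ?_, hfin.insert t⟩
    refine eq_top_iff.2 fun g _ => ?_
    obtain ⟨k, hk⟩ := ht g
    have h1 : N ≤ Subgroup.closure (insert t S) := by
      rw [← hS]
      exact Subgroup.closure_mono (Set.subset_insert t S)
    have h2 : t ∈ Subgroup.closure (insert t S) := Subgroup.subset_closure (Set.mem_insert t S)
    have := mul_mem (h1 hk) (zpow_mem h2 k)
    simpa using this

end IsPolycyclic

/-! ### Finite presentability of polycyclic groups -/

/-- Finite presentability, independent of the choice of generators. A presentation of `Q` arises
from one of `N` by adding a generator `t`, the relations expressing the `t`- and `t⁻¹`-conjugates of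
generators of `N` as elements of `N`, and one for the first power of `t` in `N`. -/
theorem IsPolycyclic.ker_isFinitelyNormallyGenerated.{u} {Q H : Type u} [Group Q] [Group H]
    (hQ : IsPolycyclic Q) (hH : Group.FG H) (f : H →* Q) (hf : Function.Surjective f) :
    f.ker.IsFinitelyNormallyGenerated := by
  refine IsPolycyclic.induction
    (R := fun Q _ => ∀ (H : Type u) [Group H] (_ : Group.FG H) (f : H →* Q),
      Function.Surjective f → f.ker.IsFinitelyNormallyGenerated)
    ?_ ?_ ?_ hQ H hH f hf
  · intro Q _ _ H _ hH f _
    have : f.ker = ⊤ := by ext; simp [MonoidHom.mem_ker, Subsingleton.elim _ (1 : Q)]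
    rw [this]
    have : Group.FG (⊤ : Subgroup H) := (Group.fg_iff_subgroup_fg _).2 (Group.fg_def.1 hH)
    exact .of_FG ⊤
  · intro Q Q' _ _ e h H _ hH f hf
    have : (e.symm.toMonoidHom.comp f).ker = f.ker := by ext; simp [MonoidHom.mem_ker]
    rw [← this]
    exact h H hH (e.symm.toMonoidHom.comp f) (e.symm.surjective.comp hf)
  · intro Q _ N _ hNpoly ih hc H _ hH f hf
    obtain ⟨t₀, ht₀⟩ := exists_zpow_mul_mem N hc
    obtain ⟨t, rfl⟩ := hf t₀
    obtain ⟨S, hS, hSfin⟩ := Group.fg_iff.1 hH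
    choose k hk using fun s : H => ht₀ (f s)
    obtain ⟨Z, hZ, hZfin⟩ := (Subgroup.fg_iff N).1 ((Group.fg_iff_subgroup_fg N).1 hNpoly.fg)
    choose l hl using hf
    -- Generators of `H` shifted into the preimage of `N` by powers of `t`, and lifts of generators
    -- of `N`. Thus `J` maps onto `N`, and `J` and `t` generate `H`.
    let Y : Set H := (fun s => s * t ^ (-k s)) '' S ∪ l '' Z
    have hYfin : Y.Finite := (hSfin.image _).union (hZfin.image _)
    let J : Subgroup H := Subgroup.closure Y
    have hJM : J ≤ N.comap f := by
      refine (Subgroup.closure_le _).2 ?_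
      rintro _ (⟨s, _, rfl⟩ | ⟨z, hz, rfl⟩)
      · simpa using hk s
      · have : z ∈ N := hZ ▸ Subgroup.subset_closure hz
        simpa [hl] using this
    have hNJ : N ≤ J.map f := by
      rw [← hZ, Subgroup.closure_le]
      exact fun z hz => ⟨l z, Subgroup.subset_closure (Or.inr ⟨z, hz, rfl⟩), hl z⟩
    let fJ : J →* N := (f.comp J.subtype).codRestrict N fun x => hJM x.2
    have hfJ : Function.Surjective fJ := by
      rintro ⟨q, hq⟩
      obtain ⟨j, hj, rfl⟩ := hNJ hq
      exact ⟨⟨j, hj⟩, rfl⟩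
    have hJfg : Group.FG J :=
      (Group.fg_iff_subgroup_fg J).2 ((Subgroup.fg_iff J).2 ⟨Y, rfl, hYfin⟩)
    obtain ⟨E, hEfin, hE⟩ := ih J hJfg fJ hfJ
    have hw : ∀ h : H, ∃ w ∈ J, f h ∈ N → f w = f h := by
      intro h
      by_cases hh : f h ∈ N
      · obtain ⟨w, hw, hwf⟩ := hNJ hh
        exact ⟨w, hw, fun _ => hwf⟩
      · exact ⟨1, one_mem J, fun h => absurd h hh⟩
    choose w hwJ hwf using hw
    -- The relator saying that `h` equals the element `w h` of `J`; it lies in the kernel when `f h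
    -- ∈ N`.
    let r : H → H := fun h => h * (w h)⁻¹
    have hr : ∀ h, f h ∈ N → f (r h) = 1 := fun h hh => by simp [r, hwf h hh]
    -- If `Q ⧸ N` is infinite then `m = 0`; the relator for `t ^ m` is then harmless, and `m ∣ i`
    -- below forces `i = 0`.
    let m : ℕ := orderOf (QuotientGroup.mk (f t) : Q ⧸ N)
    let F : Set H := J.subtype '' E ∪ ((fun y => r (t * y * t⁻¹)) '' Y ∪
      ((fun y => r (t⁻¹ * y * t)) '' Y ∪ {r (t ^ m)}))
    have hFfin : F.Finite := (hEfin.image _).union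
      ((hYfin.image _).union ((hYfin.image _).union (Set.finite_singleton _)))
    have hYN : ∀ y ∈ Y, f y ∈ N := fun y hy => hJM (Subgroup.subset_closure hy)
    have hNn : N.Normal := inferInstance
    have htm : f (t ^ m) ∈ N := by
      rw [map_pow, ← QuotientGroup.eq_one_iff, QuotientGroup.mk_pow]
      exact pow_orderOf_eq_one _
    have hFker : Subgroup.normalClosure F ≤ f.ker := by
      refine Subgroup.normalClosure_le_normal ?_
      rintro _ (⟨e, he, rfl⟩ | ⟨y, hy, rfl⟩ | ⟨y, hy, rfl⟩ | rfl)
      · have : e ∈ fJ.ker := hE ▸ Subgroup.subset_normalClosure he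
        exact congrArg Subtype.val (MonoidHom.mem_ker.1 this)
      · exact hr _ (by simpa using hNn.conj_mem _ (hYN y hy) (f t))
      · exact hr _ (by simpa using hNn.conj_mem _ (hYN y hy) (f t)⁻¹)
      · exact hr _ htm
    refine ⟨F, hFfin, le_antisymm hFker ?_⟩
    set K := Subgroup.normalClosure F
    have hFK : F ⊆ K := Subgroup.subset_normalClosure
    have hrw : ∀ h, r h ∈ K → h ∈ J ⊔ K := by
      intro h hh
      have : h = r h * w h := by simp [r]
      rw [this]
      exact mul_mem (Subgroup.mem_sup_right hh) (Subgroup.mem_sup_left (hwJ h))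
    have hKn : K.Normal := inferInstance
    have hconj : ∀ g : H, (∀ y ∈ Y, g * y * g⁻¹ ∈ J ⊔ K) →
        ∀ u ∈ J ⊔ K, g * u * g⁻¹ ∈ J ⊔ K := by
      intro g hg
      have : J ⊔ K ≤ (J ⊔ K).comap (MulAut.conj g).toMonoidHom :=
        sup_le ((Subgroup.closure_le _).2 hg)
          fun x hx => Subgroup.mem_sup_right (hKn.conj_mem x hx g)
      exact this
    have ht1 := hconj t fun y hy => hrw _ (hFK (Or.inr (Or.inl ⟨y, hy, rfl⟩)))
    have ht2 := hconj t⁻¹ fun y hy => by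
      rw [inv_inv]
      exact hrw _ (hFK (Or.inr (Or.inr (Or.inl ⟨y, hy, rfl⟩))))
    have htn : t ∈ Subgroup.normalizer ((J ⊔ K : Subgroup H) : Set H) := by
      rw [Subgroup.mem_normalizer_iff]
      refine fun u => ⟨ht1 u, fun hu => ?_⟩
      have := ht2 _ hu
      simpa [mul_assoc] using this
    have hsU : ∀ s ∈ S, s * t ^ (-k s) ∈ J ⊔ K := fun s hs =>
      Subgroup.mem_sup_left (Subgroup.subset_closure (Or.inl ⟨s, hs, rfl⟩))
    -- Modulo the relators `t` normalizes `J`, and every generator of `H` is an element of `J` times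
    -- a power of `t`.
    have hn : Subgroup.normalizer ((J ⊔ K : Subgroup H) : Set H) = ⊤ := by
      rw [eq_top_iff, ← hS, Subgroup.closure_le]
      intro s hs
      have := mul_mem (Subgroup.le_normalizer (hsU s hs)) (zpow_mem htn (k s))
      simpa using this
    have hUn : (J ⊔ K).Normal := Subgroup.normalizer_eq_top_iff.1 hn
    have htop : (J ⊔ K) ⊔ Subgroup.zpowers t = ⊤ := by
      rw [eq_top_iff, ← hS, Subgroup.closure_le]
      intro s hs
      have := mul_mem (Subgroup.mem_sup_left (T := Subgroup.zpowers t) (hsU s hs))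
        (Subgroup.mem_sup_right (zpow_mem (Subgroup.mem_zpowers t) (k s)))
      simpa using this
    have hKf : ∀ x ∈ K, f x = 1 := hFker
    have hKker : K ≤ N.comap f := fun x hx => by
      rw [Subgroup.mem_comap, hKf x hx]
      exact one_mem N
    intro h hh
    have htop_mem : h ∈ (J ⊔ K) ⊔ Subgroup.zpowers t := htop ▸ Subgroup.mem_top h
    obtain ⟨u, hu, z, hz, rfl⟩ := Subgroup.mem_sup_of_normal_left.1 htop_mem
    obtain ⟨i, rfl⟩ := Subgroup.mem_zpowers_iff.1 hz
    have huN : f u ∈ N := (sup_le hJM hKker) hu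
    have hi : f (t ^ i) ∈ N := by
      have h1 : f (t ^ i) = (f u)⁻¹ := by
        rw [MonoidHom.mem_ker, map_mul] at hh
        exact eq_inv_of_mul_eq_one_right hh
      rw [h1]
      exact inv_mem huN
    have hmi : (m : ℤ) ∣ i := by
      rw [orderOf_dvd_iff_zpow_eq_one, ← QuotientGroup.mk_zpow, QuotientGroup.eq_one_iff,
        ← map_zpow]
      exact hi
    obtain ⟨c, rfl⟩ := hmi
    have htU : t ^ ((m : ℤ) * c) ∈ J ⊔ K := by
      rw [zpow_mul, zpow_natCast]
      exact zpow_mem (hrw _ (hFK (Or.inr (Or.inr (Or.inr rfl))))) c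
    obtain ⟨j, hj, x, hx, hjx⟩ := Subgroup.mem_sup_of_normal_right.1 (mul_mem hu htU)
    rw [← hjx] at hh ⊢
    refine mul_mem ?_ hx
    have hj1 : f j = 1 := by
      rw [MonoidHom.mem_ker, map_mul, hKf x hx, mul_one] at hh
      exact hh
    have hjk : (⟨j, hj⟩ : J) ∈ fJ.ker := Subtype.ext hj1
    have hle : fJ.ker ≤ K.comap J.subtype := by
      rw [← hE]
      refine Subgroup.normalClosure_le_normal ?_
      exact fun e he => hFK (Or.inl ⟨e, he, rfl⟩)
    exact hle hjk

/-! ### Abelian sections of finite exponent in minimax groups -/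

/-- Every abelian section of finite exponent is finite. -/
def FiniteAbelianTorsionSections (G : Type*) [Group G] : Prop :=
  ∀ n : ℕ, 0 < n → ∀ N B : Subgroup G, N ≤ B → (∀ a ∈ B, ∀ b ∈ B, ⁅a, b⁆ ∈ N) →
    (∀ b ∈ B, b ^ n ∈ N) → N.relIndex B ≠ 0

namespace FiniteAbelianTorsionSections

theorem of_injective {G H : Type*} [Group G] [Group H] (hG : FiniteAbelianTorsionSections G)
    (f : H →* G) (hf : Function.Injective f) : FiniteAbelianTorsionSections H := by
  intro n hn N B hNB hc hp
  rw [← Subgroup.relIndex_map_map_of_injective N B hf]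
  refine hG n hn _ _ (Subgroup.map_mono hNB) ?_ ?_
  · rintro _ ⟨a, ha, rfl⟩ _ ⟨b, hb, rfl⟩
    exact ⟨⁅a, b⁆, hc a ha b hb, map_commutatorElement f a b⟩
  · rintro _ ⟨b, hb, rfl⟩
    exact ⟨b ^ n, hp b hb, map_pow f b n⟩

theorem subgroup {G : Type*} [Group G] (hG : FiniteAbelianTorsionSections G) (H : Subgroup G) :
    FiniteAbelianTorsionSections H := hG.of_injective H.subtype H.subtype_injective

theorem of_surjective {G H : Type*} [Group G] [Group H] (hG : FiniteAbelianTorsionSections G)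
    (f : G →* H) (hf : Function.Surjective f) : FiniteAbelianTorsionSections H := by
  intro n hn N B hNB hc hp
  have := hG n hn (N.comap f) (B.comap f) (Subgroup.comap_mono hNB)
    (fun a ha b hb => by
      rw [Subgroup.mem_comap, map_commutatorElement]
      exact hc _ ha _ hb)
    (fun b hb => by
      rw [Subgroup.mem_comap, map_pow]
      exact hp _ hb)
  rwa [Subgroup.relIndex_comap, Subgroup.map_comap_eq_self_of_surjective hf] at this

theorem quotient {G : Type*} [Group G] (hG : FiniteAbelianTorsionSections G) (N : Subgroup G)
    [N.Normal] : FiniteAbelianTorsionSections (G ⧸ N) :=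
  hG.of_surjective (QuotientGroup.mk' N) (QuotientGroup.mk'_surjective N)

/-- The index of `N` in `B` is the index of `N` in `(M ⊓ B)N`, controlled by a section of `M`, times
that of `(M ⊓ B)N` in `B`, controlled by a section of `G ⧸ M`. -/
theorem of_normal {G : Type*} [Group G] (M : Subgroup G) [M.Normal]
    (hM : FiniteAbelianTorsionSections M) (hQ : FiniteAbelianTorsionSections (G ⧸ M)) :
    FiniteAbelianTorsionSections G := by
  intro n hn N B hNB hc hp
  have hn' : (N.subgroupOf B).Normal := by
    refine ⟨fun x hx g => ?_⟩
    rw [Subgroup.mem_subgroupOf] at hx ⊢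
    have := mul_mem (hc g g.2 x x.2) hx
    simpa [commutatorElement_def] using this
  have h1 : (N.subgroupOf B).relIndex (M.subgroupOf B) ≠ 0 := by
    have := hM n hn ((N ⊓ M).subgroupOf M) ((B ⊓ M).subgroupOf M)
      (Subgroup.comap_mono (inf_le_inf_right _ hNB))
      (fun a ha b hb => by
        simp only [Subgroup.mem_subgroupOf, Subgroup.mem_inf, SetLike.coe_mem, and_true] at ha hb ⊢
        exact hc _ ha _ hb)
      (fun b hb => by
        simp only [Subgroup.mem_subgroupOf, Subgroup.mem_inf, SetLike.coe_mem, and_true] at hb ⊢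
        exact hp _ hb)
    rw [Subgroup.relIndex_subgroupOf inf_le_right] at this
    rw [Subgroup.subgroupOf, Subgroup.relIndex_comap, Subgroup.subgroupOf_map_subtype, inf_comm]
    refine fun h => this (Nat.eq_zero_of_zero_dvd ?_)
    have h2 : (N ⊓ M).relIndex (B ⊓ M) = N.relIndex (B ⊓ M) := by
      rw [← Subgroup.inf_relIndex_right N, ← Subgroup.inf_relIndex_right (N ⊓ M)]
      congr 1
      rw [inf_assoc, inf_eq_right.2 (inf_le_right : B ⊓ M ≤ M)]
    rw [h2, h]
  have h2 : (M.subgroupOf B ⊔ N.subgroupOf B).index ≠ 0 := by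
    have h3 := hQ n hn (N.map (QuotientGroup.mk' M)) (B.map (QuotientGroup.mk' M))
      (Subgroup.map_mono hNB)
      (by
        rintro _ ⟨a, ha, rfl⟩ _ ⟨b, hb, rfl⟩
        exact ⟨⁅a, b⁆, hc a ha b hb, map_commutatorElement _ a b⟩)
      (by
        rintro _ ⟨b, hb, rfl⟩
        exact ⟨b ^ n, hp b hb, map_pow _ b n⟩)
    rw [← Subgroup.relIndex_comap, Subgroup.comap_map_eq, QuotientGroup.ker_mk'] at h3
    have h4 : (N ⊔ M).subgroupOf B ≤ M.subgroupOf B ⊔ N.subgroupOf B := by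
      rintro ⟨x, hxB⟩ hx
      obtain ⟨y, hy, z, hz, hyz⟩ := Subgroup.mem_sup_of_normal_right.1 (Subgroup.mem_subgroupOf.1 hx)
      have hzB : z ∈ B := by
        have : z = y⁻¹ * x := eq_inv_mul_of_mul_eq hyz
        rw [this]
        exact mul_mem (inv_mem (hNB hy)) hxB
      have : (⟨x, hxB⟩ : B) = ⟨y, hNB hy⟩ * ⟨z, hzB⟩ := Subtype.ext hyz.symm
      rw [this]
      exact mul_mem (Subgroup.mem_sup_right (Subgroup.mem_subgroupOf.2 hy))
        (Subgroup.mem_sup_left (Subgroup.mem_subgroupOf.2 hz))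
    exact fun h => h3 (Nat.eq_zero_of_zero_dvd (h ▸ Subgroup.index_dvd_of_le h4))
  rw [Subgroup.relIndex, ← Subgroup.relIndex_mul_index
    (le_sup_right : N.subgroupOf B ≤ M.subgroupOf B ⊔ N.subgroupOf B), Subgroup.relIndex_sup_right]
  exact mul_ne_zero h1 h2

theorem of_finite (G : Type*) [Group G] [Finite G] : FiniteAbelianTorsionSections G :=
  fun _ _ _ _ _ _ _ => Subgroup.index_ne_zero_of_finite

/-- Lifts of `n + 1` elements of a section of exponent `n` would lie in a cyclic subgroup of `B`,
whose image in the section has at most `n` elements. This covers cyclic and quasicyclic factors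
together. -/
theorem of_locally_cyclic {G : Type*} [Group G]
    (hG : ∀ S : Set G, S.Finite → IsCyclic (Subgroup.closure S)) :
    FiniteAbelianTorsionSections G := by
  classical
  intro n hn N B hNB hc hp
  have hn' : (N.subgroupOf B).Normal := by
    refine ⟨fun x hx g => ?_⟩
    rw [Subgroup.mem_subgroupOf] at hx ⊢
    have := mul_mem (hc g g.2 x x.2) hx
    simpa [commutatorElement_def] using this
  rw [Subgroup.relIndex, Subgroup.index_ne_zero_iff_finite]
  by_contra hinf
  rw [not_finite_iff_infinite] at hinf
  obtain ⟨T, hT⟩ := Infinite.exists_subset_card_eq (B ⧸ N.subgroupOf B) (n + 1)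
  let S : Set G := (fun q : B ⧸ N.subgroupOf B => ((Quotient.out q : B) : G)) '' T
  obtain ⟨c, hcyc⟩ := (hG S (T.finite_toSet.image _)).exists_generator
  have hSB : Subgroup.closure S ≤ B := by
    rw [Subgroup.closure_le]
    rintro _ ⟨q, _, rfl⟩
    exact (Quotient.out q : B).2
  let c' : B ⧸ N.subgroupOf B := QuotientGroup.mk ⟨c, hSB c.2⟩
  have hcn : c' ^ n = 1 := by
    rw [← QuotientGroup.mk_pow, QuotientGroup.eq_one_iff, Subgroup.mem_subgroupOf]
    exact hp _ (hSB c.2)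
  have hord : orderOf c' ≤ n := orderOf_le_of_pow_eq_one hn hcn
  have hfo : IsOfFinOrder c' := isOfFinOrder_iff_pow_eq_one.2 ⟨n, hn, hcn⟩
  have hsub : (T : Set (B ⧸ N.subgroupOf B)) ⊆ Subgroup.zpowers c' := by
    intro q hq
    obtain ⟨k, hk⟩ := hcyc ⟨_, Subgroup.subset_closure ⟨q, hq, rfl⟩⟩
    refine ⟨k, ?_⟩
    change c' ^ k = q
    rw [← QuotientGroup.mk_zpow]
    conv_rhs => rw [← QuotientGroup.out_eq' q]
    have hk' : (c : G) ^ k = (Quotient.out q : B) := congrArg Subtype.val hk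
    congr 1
    exact Subtype.ext hk'
  have hfin : (Subgroup.zpowers c' : Set (B ⧸ N.subgroupOf B)).Finite :=
    (finite_zpowers.2 hfo)
  have h1 := Set.ncard_le_ncard hsub hfin
  rw [Set.ncard_coe_finset, hT, ← Nat.card_coe_set_eq] at h1
  have h2 : Nat.card (Subgroup.zpowers c') = orderOf c' := Nat.card_zpowers c'
  have h3 : n + 1 ≤ Nat.card (Subgroup.zpowers c') := h1
  omega

end FiniteAbelianTorsionSections

theorem IsQuasicyclic.isCyclic_closure {Q : Type*} [Group Q] (hQ : IsQuasicyclic Q) (S : Set Q)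
    (hS : S.Finite) : IsCyclic (Subgroup.closure S) := by
  obtain ⟨p, hp, ⟨e⟩⟩ := hQ
  let f : Q →* ℂˣ := (Subgroup.subtype _).comp e.toMonoidHom
  have hf : Function.Injective f := (Subgroup.subtype_injective _).comp e.injective
  let _ : CommGroup Q := { ‹Group Q› with
    mul_comm := fun a b => hf (by rw [map_mul, map_mul, mul_comm]) }
  have htor : IsMulTorsion Q := by
    intro x
    obtain ⟨k, hk⟩ := CommGroup.primaryComponent.isPGroup (e x)
    refine isOfFinOrder_iff_pow_eq_one.2 ⟨p ^ k, pow_pos hp.out.pos k, e.injective ?_⟩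
    rw [map_pow, hk, map_one]
  have hfin : Finite (Subgroup.closure S) := by
    have := hS.to_subtype
    have : Group.FG (Subgroup.closure S) := inferInstance
    exact CommGroup.finite_of_fg_isMulTorsion _ (htor.subgroup _)
  exact isCyclic_of_injective_ringHom (R := ℂ) ((Units.coeHom ℂ).comp (f.comp (Subgroup.subtype _)))
    (Units.val_injective.comp (hf.comp (Subgroup.subtype_injective _)))

theorem IsMinimax.finiteAbelianTorsionSections {G : Type*} [Group G] (hG : IsMinimax G) :
    FiniteAbelianTorsionSections G := by
  refine HasSubnormalSeries.induction (R := fun G _ => FiniteAbelianTorsionSections G)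
    ?_ ?_ ?_ hG
  · intro G _ _
    exact .of_finite G
  · intro G H _ _ e h
    exact h.of_injective e.symm.toMonoidHom e.symm.injective
  · intro G _ N _ hN hP
    refine .of_normal N hN ?_
    rcases hP with hP | hP | hP
    · exact .of_locally_cyclic fun S _ => inferInstance
    · exact .of_locally_cyclic hP.isCyclic_closure
    · exact .of_finite _

/-! ### Virtual solvability of minimax groups -/

theorem isSolvable_sup {G : Type*} [Group G] (R S : Subgroup G) [R.Normal]
    [Group.IsSolvable R] [Group.IsSolvable S] : Group.IsSolvable ↥(R ⊔ S) := by
  rw [sup_comm]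
  let e := QuotientGroup.quotientInfEquivProdNormalQuotient S R
  have : Group.IsSolvable (↥(S ⊔ R) ⧸ R.subgroupOf (S ⊔ R)) :=
    Group.isSolvable_of_surjective (f := e.toMonoidHom) e.surjective
  have : Group.IsSolvable (R.subgroupOf (S ⊔ R)) :=
    Group.isSolvable_of_isSolvable_injective
      (f := (Subgroup.subgroupOfEquivOfLe (le_sup_right : R ≤ S ⊔ R)).toMonoidHom)
      (MulEquiv.injective _)
  exact (Group.isSolvable_iff_subgroup_quotient (R.subgroupOf (S ⊔ R))).2 ⟨‹_›, ‹_›⟩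

/-- The product of all solvable normal subgroups of finite index is one of them. -/
theorem exists_greatest_solvable_normal {N : Type*} [Group N]
    (h : ∃ S : Subgroup N, Group.IsSolvable S ∧ S.FiniteIndex) :
    ∃ R : Subgroup N, R.Normal ∧ Group.IsSolvable R ∧ R.FiniteIndex ∧
      ∀ S : Subgroup N, S.Normal → Group.IsSolvable S → S ≤ R := by
  obtain ⟨S, hS, hfi⟩ := h
  let X : Set (Subgroup N) := {R | R.Normal ∧ Group.IsSolvable R ∧ R.FiniteIndex}
  have hne : X.Nonempty := by
    refine ⟨S.normalCore, inferInstance, ?_, inferInstance⟩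
    exact Group.isSolvable_of_isSolvable_injective
      (Subgroup.inclusion_injective S.normalCore_le)
  -- With `R` of least index, a solvable normal `T` outside `R` would make `R ⊔ T` a member of
  -- smaller index.
  let R := Function.argminOn Subgroup.index X hne
  obtain ⟨hn, hs, hf⟩ : R ∈ X := Function.argminOn_mem _ _ hne
  refine ⟨R, hn, hs, hf, fun T hT hTs => ?_⟩
  by_contra hle
  have hlt : R < R ⊔ T := left_lt_sup.2 hle
  have h1 := Subgroup.index_strictAnti hlt
  have h2 : R ⊔ T ∈ X := ⟨inferInstance, isSolvable_sup R T, Subgroup.finiteIndex_of_le le_sup_left⟩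
  exact absurd (Function.argminOn_le Subgroup.index X h2) (not_le.2 h1)

/-- The centralizer of `M` has finite index because `MulAut M` is finite. It is solvable, since it
meets `M` in an abelian group and has an abelian quotient by that intersection. -/
theorem exists_solvable_finiteIndex_of_finite_of_comm {G : Type*} [Group G] (M : Subgroup G)
    [M.Normal] [Finite M] (hc : ∀ a b : G, ⁅a, b⁆ ∈ M) :
    ∃ S : Subgroup G, Group.IsSolvable S ∧ S.FiniteIndex := by
  let f : G →* MulAut M := MulAut.conjNormal
  have : Finite (MulAut M) := Finite.of_injective (fun e : MulAut M => (e : M → M)) DFunLike.coe_injective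
  refine ⟨f.ker, ?_, inferInstance⟩
  have hker : ∀ g ∈ f.ker, ∀ m ∈ M, g * m = m * g := by
    intro g hg m hm
    have h1 : f g ⟨m, hm⟩ = ⟨m, hm⟩ := by rw [MonoidHom.mem_ker.1 hg]; rfl
    have h2 : g * m * g⁻¹ = m := by
      rw [← MulAut.conjNormal_apply g ⟨m, hm⟩]
      exact congrArg Subtype.val h1
    exact mul_inv_eq_iff_eq_mul.1 h2
  refine (Group.isSolvable_iff_subgroup_quotient (M.subgroupOf f.ker)).2 ⟨?_, ?_⟩
  · exact Group.isSolvable_of_comm fun a b => Subtype.ext (Subtype.ext (hker a.1 a.1.2 b.1 b.2))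
  · refine Group.isSolvable_of_comm fun a b => ?_
    induction a using QuotientGroup.induction_on with
    | H a =>
      induction b using QuotientGroup.induction_on with
      | H b =>
        rw [← QuotientGroup.mk_mul, ← QuotientGroup.mk_mul, eq_comm, QuotientGroup.eq,
          Subgroup.mem_subgroupOf]
        have := hc (a : G)⁻¹ (b : G)⁻¹
        simpa [commutatorElement_def, mul_assoc] using this

theorem IsMinimax.exists_solvable_finiteIndex {G : Type*} [Group G] (hG : IsMinimax G) :
    ∃ S : Subgroup G, Group.IsSolvable S ∧ S.FiniteIndex := by
  refine HasSubnormalSeries.induction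
    (R := fun G _ => ∃ S : Subgroup G, Group.IsSolvable S ∧ S.FiniteIndex) ?_ ?_ ?_ hG
  · intro G _ _
    exact ⟨⊤, inferInstance, inferInstance⟩
  · intro G H _ _ e ⟨S, hS, hfi⟩
    refine ⟨S.comap e.symm.toMonoidHom, ?_, ⟨?_⟩⟩
    swap
    · rw [Subgroup.index_comap_of_surjective _ e.symm.surjective]
      exact hfi.index_ne_zero
    refine Group.isSolvable_of_isSolvable_injective (f := e.symm.toMonoidHom.subgroupComap S) ?_
    intro a b hab
    exact Subtype.ext (e.symm.injective (congrArg Subtype.val hab))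
  · intro G _ N _ h hP
    by_cases hfin : Finite (G ⧸ N)
    · obtain ⟨S, hS, hfi⟩ := h
      refine ⟨S.map N.subtype, ?_, ⟨?_⟩⟩
      · exact Group.isSolvable_of_surjective (N.subtype.subgroupMap_surjective S)
      · rw [Subgroup.index_map_subtype]
        exact mul_ne_zero hfi.index_ne_zero (Subgroup.index_ne_zero_iff_finite.2 hfin)
    · have hcomm : ∀ a b : G, ⁅a, b⁆ ∈ N := by
        have : ∀ a b : G ⧸ N, a * b = b * a := by
          rcases hP with hP | hP | hP
          · exact fun a b => hP.isMulCommutative.is_comm.comm a b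
          · obtain ⟨p, _, ⟨e⟩⟩ := hP
            exact fun a b => e.injective (by rw [map_mul, map_mul, mul_comm])
          · exact absurd hP hfin
        intro a b
        rw [← QuotientGroup.eq_one_iff]
        exact commutatorElement_eq_one_iff_mul_comm.2 (this a b)
      -- Being greatest, `R` is preserved by conjugation in `G`. Modulo `R` the group is
      -- finite-by-abelian, and the preceding lemma applies.
      obtain ⟨R, hRn, hRs, hRf, hR⟩ := exists_greatest_solvable_normal h
      let R' : Subgroup G := R.map N.subtype
      have hR' : R'.Normal := by
        refine ⟨?_⟩
        rintro _ ⟨x, hx, rfl⟩ g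
        let α : N →* N := (MulAut.conjNormal g : MulAut N).toMonoidHom
        have hα : Function.Surjective α := (MulAut.conjNormal g : MulAut N).surjective
        have h1 : (R.map α).Normal := hRn.map α hα
        have h2 : Group.IsSolvable (R.map α) :=
          Group.isSolvable_of_surjective (α.subgroupMap_surjective R)
        exact ⟨α x, hR _ h1 h2 ⟨x, hx, rfl⟩, MulAut.conjNormal_apply g x⟩
      have hR's : Group.IsSolvable R' :=
        Group.isSolvable_of_surjective (N.subtype.subgroupMap_surjective R)
      have : Finite (N.map (QuotientGroup.mk' R')) := by
        have h1 : R'.relIndex N ≠ 0 := by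
          rw [Subgroup.relIndex, Subgroup.subgroupOf,
            Subgroup.comap_map_eq_self_of_injective N.subtype_injective]
          exact hRf.index_ne_zero
        have h2 := Subgroup.relIndex_ker (K := N) (QuotientGroup.mk' R')
        rw [QuotientGroup.ker_mk'] at h2
        exact Nat.finite_of_card_ne_zero (h2 ▸ h1)
      obtain ⟨S, hS, hSf⟩ := exists_solvable_finiteIndex_of_finite_of_comm
        (N.map (QuotientGroup.mk' R')) fun a b => by
          obtain ⟨a, rfl⟩ := QuotientGroup.mk'_surjective R' a
          obtain ⟨b, rfl⟩ := QuotientGroup.mk'_surjective R' b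
          exact ⟨⁅a, b⁆, hcomm a b, map_commutatorElement _ a b⟩
      refine ⟨S.comap (QuotientGroup.mk' R'), ?_, ⟨?_⟩⟩
      · refine Group.isSolvable_of_ker_le_range
          (Subgroup.inclusion (?_ : R' ≤ S.comap (QuotientGroup.mk' R')))
          ((QuotientGroup.mk' R').subgroupComap S) ?_
        · intro x hx
          rw [Subgroup.mem_comap, QuotientGroup.mk'_apply, (QuotientGroup.eq_one_iff x).2 hx]
          exact one_mem S
        · intro x hx
          have : QuotientGroup.mk' R' (x : G) = 1 := congrArg Subtype.val (MonoidHom.mem_ker.1 hx)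
          exact ⟨⟨x, (QuotientGroup.eq_one_iff _).1 this⟩, rfl⟩
      · rw [Subgroup.index_comap_of_surjective _ (QuotientGroup.mk'_surjective R')]
        exact hSf.index_ne_zero

/-! ### Common eigenvectors of polycyclic linear groups -/

theorem Group.FG.finite_monoidHom {G H : Type*} [Group G] [Group H] [Finite H]
    (hG : Group.FG G) : Finite (G →* H) := by
  obtain ⟨S, hS, hfin⟩ := Group.fg_iff.1 hG
  have := hfin.to_subtype
  refine Finite.of_injective (fun (f : G →* H) (s : S) => f s) fun f g hfg => ?_
  refine MonoidHom.eq_of_eqOn_dense hS fun s hs => ?_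
  exact congrFun hfg ⟨s, hs⟩

/-- The finitely many homomorphisms to the permutations of `G ⧸ S` are permuted by automorphisms, so
the intersection of their kernels is characteristic; the action on cosets puts it inside `S`. -/
theorem Group.FG.exists_characteristic_le {G : Type*} [Group G] (hG : Group.FG G) (S : Subgroup G)
    [S.FiniteIndex] : ∃ M ≤ S, M.Characteristic ∧ M.FiniteIndex := by
  have := hG.finite_monoidHom (H := Equiv.Perm (G ⧸ S))
  refine ⟨⨅ f : G →* Equiv.Perm (G ⧸ S), f.ker, ?_, ?_, ?_⟩
  · refine (iInf_le _ (MulAction.toPermHom G (G ⧸ S))).trans ?_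
    rw [← Subgroup.normalCore_eq_ker]
    exact S.normalCore_le
  · refine Subgroup.characteristic_iff_le_comap.2 fun φ x hx => ?_
    rw [Subgroup.mem_comap, Subgroup.mem_iInf]
    exact fun f => (Subgroup.mem_iInf.1 hx) (f.comp φ.toMonoidHom)
  · exact Subgroup.finiteIndex_iInf fun f => inferInstance

/-- A linear functional turns a relation among the `v i` into one among the characters, which are
independent by Dedekind's theorem. -/
theorem linearIndependent_of_weights {K V M ι : Type*} [Field K] [AddCommGroup V] [Module K V]
    [Monoid M] (ρ : M → V →ₗ[K] V) (v : ι → V) (hv : ∀ i, v i ≠ 0) (χ : ι → M →* K)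
    (hχ : Function.Injective χ) (h : ∀ i x, ρ x (v i) = χ i x • v i) : LinearIndependent K v := by
  rw [linearIndependent_iff']
  intro s c hc i hi
  by_contra hci
  refine hv i ((Module.forall_dual_apply_eq_zero_iff K (v i)).1 fun f => ?_)
  have h1 := (linearIndependent_monoidHom M K).comp χ hχ
  have h2 := linearIndependent_iff'.1 h1 s (fun j => c j * f (v j)) ?_ i hi
  · exact (mul_eq_zero.1 h2).resolve_left hci
  · funext x
    have h3 := congrArg (fun w => f (ρ x w)) hc
    simp only [map_sum, map_smul, h, smul_eq_mul, map_zero] at h3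
    rw [Finset.sum_apply]
    simp only [Pi.smul_apply, Function.comp_apply, smul_eq_mul, Pi.zero_apply]
    rw [← h3]
    exact Finset.sum_congr rfl fun j _ => by ring

/-- The elements acting on a nonzero vector by scalars. -/
def lineStabilizer {K V G : Type*} [Field K] [AddCommGroup V] [Module K V] [Group G]
    (ρ : G →* (V →ₗ[K] V)) (v : V) : Subgroup G where
  carrier := {g | ∃ c : K, c ≠ 0 ∧ ρ g v = c • v}
  one_mem' := ⟨1, one_ne_zero, by simp⟩
  mul_mem' := by
    rintro g h ⟨c, hc, hg⟩ ⟨d, hd, hh⟩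
    refine ⟨d * c, mul_ne_zero hd hc, ?_⟩
    rw [map_mul, Module.End.mul_apply, hh, map_smul, hg, smul_smul]
  inv_mem' := by
    rintro g ⟨c, hc, hg⟩
    refine ⟨c⁻¹, inv_ne_zero hc, ?_⟩
    rw [eq_inv_smul_iff₀ hc, ← map_smul, ← hg, ← Module.End.mul_apply, ← map_mul]
    simp

theorem mem_lineStabilizer_of_eq_smul {K V G : Type*} [Field K] [AddCommGroup V] [Module K V]
    [Group G] (ρ : G →* (V →ₗ[K] V)) {v : V} (hv : v ≠ 0) {g : G} {c : K} (h : ρ g v = c • v) :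
    g ∈ lineStabilizer ρ v := by
  refine ⟨c, ?_, h⟩
  rintro rfl
  rw [zero_smul] at h
  apply hv
  have : ρ g⁻¹ (ρ g v) = v := by
    rw [← Module.End.mul_apply, ← map_mul]
    simp
  rw [← this, h, map_zero]

/-- Write `g` as an element of `N` times `t ^ i`. Modulo `S` only the class of the first factor
modulo `M` and the residue of `i` modulo `k` matter. -/
theorem Subgroup.finiteIndex_of_zpow_mul_mem {Q : Type*} [Group Q] {N M S : Subgroup Q} [M.Normal]
    (hMN : M.relIndex N ≠ 0) {t : Q} (ht : ∀ g : Q, ∃ i : ℤ, g * t ^ (-i) ∈ N)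
    (hMS : M ≤ S) {k : ℕ} (hk : 0 < k) (htS : t ^ k ∈ S) : S.FiniteIndex := by
  have hf : Finite (N ⧸ M.subgroupOf N) := Subgroup.index_ne_zero_iff_finite.1 hMN
  rw [Subgroup.finiteIndex_iff_finite_quotient]
  let F : (N ⧸ M.subgroupOf N) × Fin k → Q ⧸ S := fun p =>
    QuotientGroup.mk ((Quotient.out p.1 : N) * t ^ (p.2 : ℕ))
  refine Finite.of_surjective F fun q => ?_
  obtain ⟨g, rfl⟩ := QuotientGroup.mk_surjective q
  obtain ⟨i, hi⟩ := ht g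
  have hk' : (0 : ℤ) < k := by exact_mod_cast hk
  obtain ⟨j, hj⟩ := Int.eq_ofNat_of_zero_le (Int.emod_nonneg i hk'.ne')
  have hjk : j < k := by
    have := Int.emod_lt_of_pos i hk'
    omega
  refine ⟨(QuotientGroup.mk ⟨_, hi⟩, ⟨j, hjk⟩), ?_⟩
  obtain ⟨m, hm⟩ := QuotientGroup.mk_out_eq_mul (M.subgroupOf N) ⟨_, hi⟩
  simp only [F]
  rw [hm, eq_comm, QuotientGroup.eq]
  have e : i = j + k * (i / k) := by rw [← hj]; exact (Int.emod_add_mul_ediv i k).symm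
  have hmM : ((m : N) : Q) ∈ M := Subgroup.mem_subgroupOf.1 m.2
  have h1 : g⁻¹ * (((⟨g * t ^ (-i), hi⟩ * (m : N) : N) : Q) * t ^ j) =
      (t ^ k) ^ (-(i / k)) * ((t ^ j)⁻¹ * ((m : N) : Q) * (t ^ j)⁻¹⁻¹) := by
    have h2 : t ^ (-i) = (t ^ k) ^ (-(i / k)) * (t ^ j)⁻¹ := by
      rw [← zpow_natCast t k, ← zpow_natCast t j, ← zpow_neg, ← zpow_mul, ← zpow_add]
      congr 1
      rw [mul_neg]
      omega
    simp only [Subgroup.coe_mul, h2]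
    group
  rw [h1]
  exact mul_mem (zpow_mem htS _) (hMS (Subgroup.Normal.conj_mem inferInstance _ hmM _))

/-- A form of Mal'cev's theorem. A finite-index characteristic subgroup of `N` acts on some `v` by a
character. Its translates under powers of `t` are weights of a finite-dimensional space, so a
positive power `t ^ k` fixes the character and has an eigenvector in its weight space. -/
theorem IsPolycyclic.exists_common_eigenvector {Q : Type*} [Group Q] (hQ : IsPolycyclic Q)
    {K V : Type*} [Field K] [IsAlgClosed K] [AddCommGroup V] [Module K V]
    [FiniteDimensional K V] [Nontrivial V] (ρ : Q →* (V →ₗ[K] V)) :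
    ∃ v : V, v ≠ 0 ∧ (lineStabilizer ρ v).FiniteIndex := by
  refine IsPolycyclic.induction
    (R := fun Q _ => ∀ ρ : Q →* (V →ₗ[K] V), ∃ v : V, v ≠ 0 ∧ (lineStabilizer ρ v).FiniteIndex)
    ?_ ?_ ?_ hQ ρ
  · intro Q _ _ ρ
    obtain ⟨v, hv⟩ := exists_ne (0 : V)
    exact ⟨v, hv, inferInstance⟩
  · intro Q Q' _ _ e h ρ
    obtain ⟨v, hv, hf⟩ := h (ρ.comp e.toMonoidHom)
    refine ⟨v, hv, ⟨?_⟩⟩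
    have : lineStabilizer (ρ.comp e.toMonoidHom) v = (lineStabilizer ρ v).comap e.toMonoidHom := rfl
    rw [this] at hf
    have h1 := hf.index_ne_zero
    rwa [Subgroup.index_comap_of_surjective _ e.surjective] at h1
  · intro Q _ N _ hN ih hc ρ
    obtain ⟨v, hv, hf⟩ := ih (ρ.comp N.subtype)
    obtain ⟨M₀, hM₀, hchar, hfin⟩ := hN.fg.exists_characteristic_le
      (lineStabilizer (ρ.comp N.subtype) v)
    obtain ⟨t, ht⟩ := exists_zpow_mul_mem N hc
    let M : Subgroup Q := M₀.map N.subtype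
    have hMn : M.Normal := inferInstance
    have hMN : M.relIndex N ≠ 0 := by
      rw [Subgroup.relIndex, Subgroup.subgroupOf,
        Subgroup.comap_map_eq_self_of_injective N.subtype_injective]
      exact hfin.index_ne_zero
    have hMv : ∀ x : M, ∃ c : K, ρ x v = c • v := by
      rintro ⟨_, x, hx, rfl⟩
      obtain ⟨c, _, hc⟩ := hM₀ hx
      exact ⟨c, hc⟩
    choose c hc using hMv
    have hinj : ∀ a b : K, a • v = b • v → a = b := fun a b h => smul_left_injective K hv h
    let χ : M →* K :=
      { toFun := c
        map_one' := hinj _ _ (by rw [← hc]; simp)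
        map_mul' := fun x y => hinj _ _ (by
          rw [← hc, Subgroup.coe_mul, map_mul, Module.End.mul_apply, hc, map_smul, hc, smul_smul,
            mul_comm]) }
    have hχ : ∀ x : M, ρ x v = χ x • v := hc
    have hcancel : ∀ (g : Q) (w : V), ρ g⁻¹ (ρ g w) = w := fun g w => by
      rw [← Module.End.mul_apply, ← map_mul]
      simp
    -- `χ' i` is the weight of `ρ (t ^ i) v`.
    let χ' : ℕ → M →* K := fun i =>
      χ.comp (MulAut.conjNormal (t ^ i)⁻¹ : MulAut M).toMonoidHom
    have hconj : ∀ (g : Q) (x : M) (w : V),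
        ρ x (ρ g w) = ρ g (ρ (MulAut.conjNormal g⁻¹ x : M) w) := by
      intro g x w
      rw [← Module.End.mul_apply, ← Module.End.mul_apply, ← map_mul, ← map_mul,
        MulAut.conjNormal_apply]
      congr 2
      group
    have hχ' : ∀ i x, ρ (x : M) (ρ (t ^ i) v) = χ' i x • ρ (t ^ i) v := by
      intro i x
      rw [hconj, hχ, map_smul]
      rfl
    have hnot : ¬ Function.Injective χ' := by
      intro hinj
      have hli := linearIndependent_of_weights (fun x : M => ρ x) (fun i : ℕ => ρ (t ^ i) v)
        (fun i h => hv (by rw [← hcancel (t ^ i) v, h, map_zero])) χ' hinj hχ'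
      exact not_finite_iff_infinite.2 (inferInstanceAs (Infinite ℕ)) hli.finite
    obtain ⟨k, hk, hkχ⟩ : ∃ k : ℕ, 0 < k ∧ ∀ x : M, χ (MulAut.conjNormal (t ^ k)⁻¹ x) = χ x := by
      rw [Function.Injective] at hnot
      push Not at hnot
      obtain ⟨i, j, hij, hne⟩ := hnot
      have main : ∀ i j : ℕ, χ' i = χ' j → i < j →
          ∃ k : ℕ, 0 < k ∧ ∀ x : M, χ (MulAut.conjNormal (t ^ k)⁻¹ x) = χ x := by
        intro i j hij hlt
        refine ⟨j - i, Nat.sub_pos_of_lt hlt, fun x => ?_⟩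
        have h1 := DFunLike.congr_fun hij (MulAut.conjNormal (t ^ i) x)
        have h2 : ∀ l, χ' l (MulAut.conjNormal (t ^ i) x) =
            χ (MulAut.conjNormal ((t ^ l)⁻¹ * t ^ i) x) := by
          intro l
          rw [map_mul]
          rfl
        rw [h2, h2] at h1
        have h3 : (t ^ (j - i))⁻¹ = (t ^ j)⁻¹ * t ^ i := by
          have : t ^ j = t ^ i * t ^ (j - i) := by
            rw [← pow_add, Nat.add_sub_cancel' hlt.le]
          rw [this, mul_inv_rev, mul_assoc, inv_mul_cancel, mul_one]
        rw [h3, ← h1]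
        simp
      rcases lt_or_gt_of_ne hne with h | h
      · exact main i j hij h
      · exact main j i hij.symm h
    let W : Submodule K V :=
      { carrier := {w | ∀ x : M, ρ x w = χ x • w}
        zero_mem' := by simp
        add_mem' := fun {a b} ha hb x => by rw [map_add, ha, hb, smul_add]
        smul_mem' := fun r a ha x => by rw [map_smul, ha, smul_comm] }
    have hW : ∀ w ∈ W, ρ (t ^ k) w ∈ W := by
      intro w hw x
      rw [hconj, hw, hkχ, map_smul]
    have hWn : Nontrivial W := ⟨⟨⟨v, hχ⟩, 0, fun h => hv (congrArg Subtype.val h)⟩⟩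
    obtain ⟨μ, hμ⟩ := Module.End.exists_eigenvalue ((ρ (t ^ k)).restrict hW)
    obtain ⟨⟨w, hwW⟩, hw⟩ := hμ.exists_hasEigenvector
    have hw0 : w ≠ 0 := fun h => hw.2 (Subtype.ext h)
    have hwμ : ρ (t ^ k) w = μ • w := congrArg Subtype.val hw.apply_eq_smul
    exact ⟨w, hw0, Subgroup.finiteIndex_of_zpow_mul_mem hMN ht
      (fun x hx => mem_lineStabilizer_of_eq_smul ρ hw0 (hwW ⟨x, hx⟩)) hk
      (mem_lineStabilizer_of_eq_smul ρ hw0 hwμ)⟩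

/-! ### Finite rank and homomorphisms into a field -/

theorem LinearIndependent.not_sub_mem_two_span {M ι : Type*} [AddCommGroup M] {v : ι → M}
    (hv : LinearIndependent ℤ v) {i j : ι} {x : M} (hx : x ∈ Submodule.span ℤ (Set.range v))
    (h : v i - v j = (2 : ℤ) • x) : i = j := by
  classical
  by_contra hij
  obtain ⟨c, rfl⟩ := (Finsupp.mem_span_range_iff_exists_finsupp).1 hx
  have h1 : Finsupp.linearCombination ℤ v (Finsupp.single i 1 - Finsupp.single j 1) =
      Finsupp.linearCombination ℤ v ((2 : ℤ) • c) := by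
    rw [map_sub, map_smul, Finsupp.linearCombination_single, Finsupp.linearCombination_single,
      one_smul, one_smul, h]
    rfl
  have h2 := DFunLike.congr_fun (hv.finsuppLinearCombination_injective h1) i
  simp only [Finsupp.coe_sub, Pi.sub_apply, Finsupp.single_eq_same, Finsupp.coe_smul,
    Pi.smul_apply, smul_eq_mul, Finsupp.single_eq_of_ne hij] at h2
  omega

namespace FiniteAbelianTorsionSections

/-- The span `B` of `v` is free abelian and `B / B²` has exponent two, hence is finite; the `v i`
stay distinct in it. -/
theorem finite_of_linearIndependent {A ι : Type*} [CommGroup A]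
    (hA : FiniteAbelianTorsionSections A) {v : ι → Additive A} (hv : LinearIndependent ℤ v) :
    Finite ι := by
  let S : Submodule ℤ (Additive A) := Submodule.span ℤ (Set.range v)
  let B : Subgroup A := AddSubgroup.toSubgroup' S.toAddSubgroup
  have hB : ∀ i, (v i).toMul ∈ B := fun i => show v i ∈ S from Submodule.subset_span ⟨i, rfl⟩
  have h := hA 2 two_pos (B.map (powMonoidHom 2)) B
    (by rintro _ ⟨x, hx, rfl⟩; exact pow_mem hx 2)
    (fun a _ b _ => by
      rw [commutatorElement_eq_one_iff_mul_comm.2 (mul_comm a b)]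
      exact one_mem _)
    (fun b hb => ⟨b, hb, rfl⟩)
  have hfin : Finite (B ⧸ (B.map (powMonoidHom 2)).subgroupOf B) :=
    Subgroup.index_ne_zero_iff_finite.1 h
  refine Finite.of_injective (fun i => (QuotientGroup.mk ⟨(v i).toMul, hB i⟩ :
    B ⧸ (B.map (powMonoidHom 2)).subgroupOf B)) fun i j hij => ?_
  obtain ⟨x, hx, hxe⟩ := Subgroup.mem_subgroupOf.1 (QuotientGroup.eq.1 hij.symm)
  refine hv.not_sub_mem_two_span (x := Additive.ofMul x) hx ?_
  have : Additive.ofMul (x ^ 2) = v i - v j := by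
    change x ^ 2 = (v j).toMul⁻¹ * (v i).toMul at hxe
    rw [hxe, mul_comm, ← div_eq_mul_inv]
    rfl
  rw [← this, ofMul_pow]
  exact (natCast_zsmul _ 2).symm

/-- Every element of `A` has a nonzero multiple in the span of a maximal independent set, so a
homomorphism to `K` is determined by its values on that finite set. -/
theorem finiteDimensional_hom {A : Type*} [CommGroup A] (hA : FiniteAbelianTorsionSections A)
    (K : Type*) [Field K] [CharZero K] : FiniteDimensional K (Additive A →+ K) := by
  obtain ⟨s, hs, hmax⟩ := exists_maximal_linearIndepOn ℤ (id : Additive A → Additive A)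
  have : Finite s := hA.finite_of_linearIndependent hs
  let f : (Additive A →+ K) →ₗ[K] (s → K) :=
    { toFun := fun φ i => φ i
      map_add' := fun _ _ => rfl
      map_smul' := fun _ _ => rfl }
  refine FiniteDimensional.of_injective f ((injective_iff_map_eq_zero f).2 fun φ hφ => ?_)
  have hspan : ∀ x ∈ Submodule.span ℤ s, φ x = 0 := by
    intro x hx
    induction hx using Submodule.span_induction with
    | mem x hx => exact congrFun hφ ⟨x, hx⟩
    | zero => exact map_zero φ
    | add x y _ _ hx hy => rw [map_add, hx, hy, add_zero]
    | smul n x _ hx => rw [map_zsmul, hx, smul_zero]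
  ext a
  by_cases ha : a ∈ s
  · exact hspan a (Submodule.subset_span ha)
  · obtain ⟨n, hn, hna⟩ := hmax a ha
    rw [Set.image_id] at hna
    have h := hspan _ hna
    simp only [map_zsmul, zsmul_eq_mul] at h
    exact (mul_eq_zero.1 h).resolve_left (by exact_mod_cast hn)

end FiniteAbelianTorsionSections

theorem AddCommGroup.exists_hom_extension {M N K : Type*} [AddCommGroup M] [AddCommGroup N]
    [Field K] [CharZero K] (f : M →+ N) (hf : Function.Injective f) (g : M →+ K) :
    ∃ h : N →+ K, ∀ x, h (f x) = g x := by
  obtain ⟨h, hh⟩ := (Module.Baer.of_divisible K).extension_property_addMonoidHom f hf g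
  exact ⟨h, DFunLike.congr_fun hh⟩

theorem nontrivial_hom_of_torsionFree {A : Type*} [CommGroup A] {a : A}
    (ha : ∀ n : ℤ, a ^ n = 1 → n = 0) (K : Type*) [Field K] [CharZero K] :
    Nontrivial (Additive A →+ K) := by
  obtain ⟨h, hh⟩ := AddCommGroup.exists_hom_extension (zmultiplesHom (Additive A) (Additive.ofMul a))
    ((injective_iff_map_eq_zero _).2 fun n hn => ha n hn) (Int.castAddHom K)
  refine ⟨h, 0, fun h0 => ?_⟩
  have := hh 1
  simp [h0] at this

/-- A group with a polycyclic quotient by a central subgroup `Z` has only finitely generated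
intersection of its commutator subgroup with `Z`. -/
theorem exists_fg_of_central {C : Type*} [Group C] (Z : Subgroup C) [Z.Normal]
    (hZ : Z ≤ Subgroup.center C) (hC : IsPolycyclic (C ⧸ Z)) :
    ∃ F ≤ Z, F.FG ∧ commutator C ⊓ Z ≤ F := by
  obtain ⟨T, hT, hTfin⟩ := Group.fg_iff.1 hC.fg
  choose l hl using QuotientGroup.mk_surjective (s := Z)
  -- Here `C = DZ` with `Z` central, so all commutators of `C` lie in `D`. It remains to see that `D
  -- ⊓ Z` is finitely generated: it is the kernel of `D → C ⧸ Z`, normally generated by a finite set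
  -- and central.
  let D : Subgroup C := Subgroup.closure (l '' T)
  have hDfg : Group.FG D :=
    (Group.fg_iff_subgroup_fg D).2 ((Subgroup.fg_iff D).2 ⟨_, rfl, hTfin.image l⟩)
  let f : D →* C ⧸ Z := (QuotientGroup.mk' Z).comp D.subtype
  have hf : Function.Surjective f := by
    rw [← MonoidHom.range_eq_top, eq_top_iff, ← hT, Subgroup.closure_le]
    intro q hq
    exact ⟨⟨l q, Subgroup.subset_closure ⟨q, hq, rfl⟩⟩, hl q⟩
  have hker : f.ker = Z.subgroupOf D := by
    ext x
    simp [f, MonoidHom.mem_ker, Subgroup.mem_subgroupOf]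
  obtain ⟨E, hE, hEn⟩ := hC.ker_isFinitelyNormallyGenerated hDfg f hf
  have hEc : ∀ x ∈ f.ker, ∀ y : D, y * x = x * y := by
    intro x hx y
    rw [hker, Subgroup.mem_subgroupOf] at hx
    exact Subtype.ext (Subgroup.mem_center_iff.1 (hZ hx) y)
  have hcl : Subgroup.closure E = f.ker := by
    have hle : Subgroup.closure E ≤ f.ker := by
      rw [← hEn]
      exact Subgroup.closure_le_normalClosure
    have hn : (Subgroup.closure E).Normal := by
      refine ⟨fun x hx g => ?_⟩
      rw [hEc x (hle hx) g, mul_assoc, mul_inv_cancel, mul_one]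
      exact hx
    refine le_antisymm hle ?_
    rw [← hEn]
    exact Subgroup.normalClosure_le_normal Subgroup.subset_closure
  refine ⟨f.ker.map D.subtype, ?_, ?_, ?_⟩
  · rw [hker, Subgroup.subgroupOf_map_subtype]
    exact inf_le_left
  · rw [Subgroup.fg_iff]
    refine ⟨D.subtype '' E, ?_, hE.image _⟩
    rw [← hcl, MonoidHom.map_closure]
  · rw [hker, Subgroup.subgroupOf_map_subtype]
    have hcom : commutator C ≤ D := by
      rw [commutator_def, Subgroup.commutator_le]
      intro a _ b _
      obtain ⟨a', ha'⟩ := hf (QuotientGroup.mk a)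
      obtain ⟨b', hb'⟩ := hf (QuotientGroup.mk b)
      obtain ⟨z, hz, rfl⟩ : ∃ z ∈ Z, a = a' * z := ⟨_, QuotientGroup.eq.1 ha', by simp⟩
      obtain ⟨w, hw, rfl⟩ : ∃ w ∈ Z, b = b' * w := ⟨_, QuotientGroup.eq.1 hb', by simp⟩
      have hz' := Subgroup.mem_center_iff.1 (hZ hz)
      have hw' := Subgroup.mem_center_iff.1 (hZ hw)
      have : ⁅(a' : C) * z, (b' : C) * w⁆ = ⁅(a' : C), (b' : C)⁆ := by
        simp only [commutatorElement_def, mul_inv_rev]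
        calc (a' : C) * z * (b' * w) * (z⁻¹ * (a' : C)⁻¹) * (w⁻¹ * (b' : C)⁻¹)
            = a' * (z * (b' * w)) * (z⁻¹ * (a' : C)⁻¹) * (w⁻¹ * (b' : C)⁻¹) := by group
          _ = a' * ((b' * w) * z) * (z⁻¹ * (a' : C)⁻¹) * (w⁻¹ * (b' : C)⁻¹) := by rw [hz']
          _ = a' * b' * (w * (a' : C)⁻¹) * (w⁻¹ * (b' : C)⁻¹) := by group
          _ = a' * b' * ((a' : C)⁻¹ * w) * (w⁻¹ * (b' : C)⁻¹) := by rw [hw']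
          _ = _ := by group
      rw [this]
      exact (⁅a', b'⁆ : D).2
    exact le_inf inf_le_right (inf_le_left.trans hcom)

/-! ### Scalar actions and the integral case -/

/-- `φ` embeds the abelian normal subgroup `A` of `G` into the field `K` in such a way that
`G` acts on `A` through multiplication by the scalars `χ g`. -/
structure ScalarAction {G K : Type*} [Group G] [Field K] (A : Subgroup G) (φ : G → K)
    (χ : G →* K) : Prop where
  map_mul : ∀ a ∈ A, ∀ b ∈ A, φ (a * b) = φ a + φ b
  eq_one : ∀ a ∈ A, φ a = 0 → a = 1
  map_conj : ∀ g, ∀ a ∈ A, φ (g * a * g⁻¹) = χ g * φ a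

namespace ScalarAction

variable {G K : Type*} [Group G] [Field K] {A : Subgroup G} {φ : G → K} {χ : G →* K}

theorem map_one (h : ScalarAction A φ χ) : φ 1 = 0 := by
  have := h.map_mul 1 (one_mem A) 1 (one_mem A)
  simpa using this

theorem map_inv (h : ScalarAction A φ χ) {a : G} (ha : a ∈ A) : φ a⁻¹ = -φ a := by
  have := h.map_mul a⁻¹ (inv_mem ha) a ha
  rw [inv_mul_cancel, h.map_one] at this
  exact eq_neg_of_add_eq_zero_left this.symm

/-- The embedding of `A` into `K` as an additive homomorphism. -/
def hom (h : ScalarAction A φ χ) : Additive A →+ K where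
  toFun a := φ a.toMul
  map_zero' := h.map_one
  map_add' a b := h.map_mul _ a.toMul.2 _ b.toMul.2

theorem inj (h : ScalarAction A φ χ) {a b : G} (ha : a ∈ A) (hb : b ∈ A) (hab : φ a = φ b) :
    a = b := by
  rw [← mul_inv_eq_one]
  refine h.eq_one _ (mul_mem ha (inv_mem hb)) ?_
  rw [h.map_mul _ ha _ (inv_mem hb), h.map_inv hb, hab, add_neg_cancel]

theorem map_zpow (h : ScalarAction A φ χ) {a : G} (ha : a ∈ A) (n : ℤ) : φ (a ^ n) = n * φ a := by
  have := _root_.map_zsmul h.hom n (Additive.ofMul ⟨a, ha⟩)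
  rw [zsmul_eq_mul] at this
  exact this

theorem comm (h : ScalarAction A φ χ) {a b : G} (ha : a ∈ A) (hb : b ∈ A) : a * b = b * a :=
  h.inj (mul_mem ha hb) (mul_mem hb ha) (by
    rw [h.map_mul _ ha _ hb, h.map_mul _ hb _ ha, add_comm])

theorem chi_ne_zero (χ : G →* K) (g : G) : χ g ≠ 0 := by
  intro h
  have : χ (g * g⁻¹) = 0 := by rw [_root_.map_mul, h, zero_mul]
  rw [mul_inv_cancel, _root_.map_one] at this
  exact one_ne_zero this

theorem chi_eq_one (h : ScalarAction A φ χ) (hA : A ≠ ⊥) {a : G} (ha : a ∈ A) : χ a = 1 := by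
  obtain ⟨⟨b, hb⟩, hb1⟩ := Subgroup.ne_bot_iff_exists_ne_one.1 hA
  have h1 := h.map_conj a b hb
  rw [h.comm ha hb, mul_inv_cancel_right] at h1
  have h2 : φ b ≠ 0 := fun h0 => hb1 (Subtype.ext (h.eq_one _ hb h0))
  exact (mul_right_cancel₀ h2 (by rw [one_mul, ← h1])).symm

/-- The image in `K` of a subgroup of `A`. -/
def image (h : ScalarAction A φ χ) (B : Subgroup G) (hB : B ≤ A) : Submodule ℤ K :=
  AddSubgroup.toIntSubmodule
    { carrier := {z | ∃ b ∈ B, φ b = z}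
      zero_mem' := ⟨1, one_mem B, h.map_one⟩
      add_mem' := by
        rintro _ _ ⟨a, ha, rfl⟩ ⟨b, hb, rfl⟩
        exact ⟨a * b, mul_mem ha hb, h.map_mul _ (hB ha) _ (hB hb)⟩
      neg_mem' := by
        rintro _ ⟨a, ha, rfl⟩
        exact ⟨a⁻¹, inv_mem ha, h.map_inv (hB ha)⟩ }

theorem image_fg (h : ScalarAction A φ χ) {B : Subgroup G} (hB : B ≤ A) (hfg : B.FG) :
    (h.image B hB).FG := by
  obtain ⟨E, rfl, hE⟩ := (Subgroup.fg_iff B).1 hfg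
  refine Submodule.fg_def.2 ⟨φ '' E, hE.image φ, le_antisymm (Submodule.span_le.2 ?_) ?_⟩
  · rintro _ ⟨e, he, rfl⟩
    exact ⟨e, Subgroup.subset_closure he, rfl⟩
  · rintro _ ⟨b, hb, rfl⟩
    induction hb using Subgroup.closure_induction with
    | mem x hx => exact Submodule.subset_span ⟨x, hx, rfl⟩
    | one => rw [h.map_one]; exact zero_mem _
    | mul x y hx hy ihx ihy => rw [h.map_mul _ (hB hx) _ (hB hy)]; exact add_mem ihx ihy
    | inv x hx ih => rw [h.map_inv (hB hx)]; exact neg_mem ih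

theorem fg_of_image_fg (h : ScalarAction A φ χ) {B : Subgroup G} (hB : B ≤ A)
    (hfg : (h.image B hB).FG) : B.FG := by
  obtain ⟨T, hT, hspan⟩ := Submodule.fg_def.1 hfg
  have hTB : ∀ z : T, ∃ b ∈ B, φ b = z := fun z => by
    have : (z : K) ∈ h.image B hB := hspan ▸ Submodule.subset_span z.2
    exact this
  choose l hlB hl using hTB
  have := hT.to_subtype
  refine (Subgroup.fg_iff B).2 ⟨Set.range l, ?_, Set.finite_range l⟩
  have hle : Subgroup.closure (Set.range l) ≤ B := by
    rw [Subgroup.closure_le]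
    rintro _ ⟨z, rfl⟩
    exact hlB z
  refine le_antisymm hle fun b hb => ?_
  have h1 : h.image B hB ≤ h.image _ (hle.trans hB) := by
    rw [← hspan, Submodule.span_le]
    exact fun z hz => ⟨l ⟨z, hz⟩, Subgroup.subset_closure ⟨_, rfl⟩, hl ⟨z, hz⟩⟩
  obtain ⟨c, hc, hcb⟩ := h1 (⟨b, hb, rfl⟩ : φ b ∈ h.image B hB)
  rwa [← h.inj (hB (hle hc)) (hB hb) hcb]

/-- By integrality the values of `χ` lie in a ring `R` that is a finitely generated `ℤ`-module. As
`A` is the normal closure of a finite set `E`, its image lies in `R · φ(E)`, so `A` is finitely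
generated. -/
theorem isPolycyclic_of_isIntegral [A.Normal] (h : ScalarAction A φ χ) (hfg : Group.FG G)
    (hQ : IsPolycyclic (G ⧸ A)) (hint : ∀ g, IsIntegral ℤ (χ g)) : IsPolycyclic G := by
  obtain ⟨E, hE, hEA⟩ := hQ.ker_isFinitelyNormallyGenerated hfg (QuotientGroup.mk' A)
    (QuotientGroup.mk'_surjective A)
  rw [QuotientGroup.ker_mk'] at hEA
  obtain ⟨S, hS, hSfin⟩ := Group.fg_iff.1 hfg
  let T : Set K := χ '' S ∪ (fun g => χ g⁻¹) '' S
  let R : Subalgebra ℤ K := Algebra.adjoin ℤ T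
  have hR : R.toSubmodule.FG := by
    refine fg_adjoin_of_finite ((hSfin.image _).union (hSfin.image _)) ?_
    rintro _ (⟨g, _, rfl⟩ | ⟨g, _, rfl⟩) <;> exact hint _
  have hχ : ∀ g, χ g ∈ R ∧ χ g⁻¹ ∈ R := by
    intro g
    have hg : g ∈ Subgroup.closure S := hS ▸ Subgroup.mem_top g
    induction hg using Subgroup.closure_induction with
    | mem x hx =>
      exact ⟨Algebra.subset_adjoin (Or.inl ⟨x, hx, rfl⟩),
        Algebra.subset_adjoin (Or.inr ⟨x, hx, rfl⟩)⟩
    | one => simp [one_mem]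
    | mul x y _ _ hx hy =>
      rw [mul_inv_rev, _root_.map_mul, _root_.map_mul]
      exact ⟨mul_mem hx.1 hy.1, mul_mem hy.2 hx.2⟩
    | inv x _ hx => rw [inv_inv]; exact hx.symm
  let P : Submodule ℤ K := R.toSubmodule * Submodule.span ℤ (φ '' E)
  have hP : P.FG := hR.mul (Submodule.fg_span (hE.image φ))
  have hRP : ∀ r ∈ R, ∀ z ∈ P, r * z ∈ P := by
    intro r hr z hz
    have h1 : r * z ∈ R.toSubmodule * P := Submodule.mul_mem_mul hr hz
    have h2 : R.toSubmodule * R.toSubmodule = R.toSubmodule := R.isIdempotentElem_toSubmodule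
    rwa [← mul_assoc, h2] at h1
  let N : Subgroup G :=
    { carrier := {a | a ∈ A ∧ φ a ∈ P}
      one_mem' := ⟨one_mem A, by rw [h.map_one]; exact zero_mem P⟩
      mul_mem' := fun ha hb => ⟨mul_mem ha.1 hb.1, by
        rw [h.map_mul _ ha.1 _ hb.1]; exact add_mem ha.2 hb.2⟩
      inv_mem' := fun ha => ⟨inv_mem ha.1, by rw [h.map_inv ha.1]; exact neg_mem ha.2⟩ }
  have hN : N.Normal := by
    refine ⟨fun a ha g => ⟨Subgroup.Normal.conj_mem inferInstance a ha.1 g, ?_⟩⟩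
    rw [h.map_conj g a ha.1]
    exact hRP _ (hχ g).1 _ ha.2
  have hAN : A ≤ N := by
    conv_lhs => rw [← hEA]
    refine Subgroup.normalClosure_le_normal fun e he => ⟨?_, ?_⟩
    · rw [← hEA]
      exact Subgroup.subset_normalClosure he
    · have h1 : (1 : K) * φ e ∈ P :=
        Submodule.mul_mem_mul (one_mem R) (Submodule.subset_span ⟨e, he, rfl⟩)
      rwa [one_mul] at h1
  have hAfg : A.FG := by
    refine h.fg_of_image_fg le_rfl (hP.of_le ?_)
    rintro _ ⟨a, ha, rfl⟩
    exact (hAN ha).2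
  exact .of_normal A (.of_comm_fg (fun a b => Subtype.ext (h.comm a.2 b.2))
    ((Group.fg_iff_subgroup_fg A).2 hAfg)) hQ

theorem exists_aeval_mul (h : ScalarAction A φ χ) {μ : K}
    (hμ : ∀ a ∈ A, ∃ b ∈ A, φ b = μ * φ a) (p : Polynomial ℤ) :
    ∀ a ∈ A, ∃ b ∈ A, φ b = Polynomial.aeval μ p * φ a := by
  induction p using Polynomial.induction_on with
  | C n =>
    intro a ha
    exact ⟨a ^ n, zpow_mem ha n, by rw [h.map_zpow ha]; simp⟩
  | add p q hp hq =>
    intro a ha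
    obtain ⟨b, hb, hb'⟩ := hp a ha
    obtain ⟨c, hc, hc'⟩ := hq a ha
    exact ⟨b * c, mul_mem hb hc, by rw [h.map_mul _ hb _ hc, hb', hc', map_add, add_mul]⟩
  | monomial n r ih =>
    intro a ha
    obtain ⟨b, hb, hb'⟩ := hμ a ha
    obtain ⟨c, hc, hc'⟩ := ih b hb
    refine ⟨c, hc, ?_⟩
    rw [hc', hb']
    simp only [_root_.map_mul, map_pow, Polynomial.aeval_X, pow_succ]
    ring

/-- For transcendental `μ` the elements of `A` with images `μ ^ n * φ a` would be independent,
against finite rank. -/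
theorem isAlgebraic_of_mul_mem [CharZero K] (h : ScalarAction A φ χ)
    (hF : FiniteAbelianTorsionSections G) (hA : A ≠ ⊥) {μ : K}
    (hμ : ∀ a ∈ A, ∃ b ∈ A, φ b = μ * φ a) : IsAlgebraic ℤ μ := by
  by_contra htr
  obtain ⟨a, ha1⟩ := Subgroup.ne_bot_iff_exists_ne_one.1 hA
  have ha0 : φ a ≠ 0 := fun h0 => ha1 (Subtype.ext (h.eq_one _ a.2 h0))
  choose v hvA hv using fun n : ℕ => h.exists_aeval_mul hμ (Polynomial.X ^ n) a a.2
  let _ : CommGroup A := { (inferInstance : Group A) with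
    mul_comm := fun a b => Subtype.ext (h.comm a.2 b.2) }
  let w : ℕ → Additive A := fun n => Additive.ofMul ⟨v n, hvA n⟩
  have hw : LinearIndependent ℤ w := by
    refine LinearIndependent.of_comp h.hom.toIntLinearMap ?_
    let T : Polynomial ℤ →ₗ[ℤ] K :=
      (LinearMap.mulRight ℤ (φ a)).comp (Polynomial.aeval μ).toLinearMap
    have hT : LinearMap.ker T = ⊥ := by
      rw [LinearMap.ker_eq_bot, injective_iff_map_eq_zero]
      intro p hp
      have h1 : Polynomial.aeval μ p * φ a = 0 := hp
      have h2 := (mul_eq_zero.1 h1).resolve_right ha0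
      by_contra hp0
      exact htr ⟨p, hp0, h2⟩
    have h3 := (Polynomial.basisMonomials ℤ).linearIndependent.map' T hT
    have h4 : ⇑h.hom.toIntLinearMap ∘ w = T ∘ Polynomial.basisMonomials ℤ := by
      funext n
      change φ (v n) = Polynomial.aeval μ (Polynomial.basisMonomials ℤ n) * φ a
      rw [hv, Polynomial.coe_basisMonomials]
      beta_reduce
      rw [Polynomial.monomial_one_right_eq_X_pow]
    rw [h4]
    exact h3
  have := (hF.subgroup A).finite_of_linearIndependent hw
  exact not_finite_iff_infinite.2 (inferInstanceAs (Infinite ℕ)) this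

/-- As `μ` is algebraic and nonzero, it is a root of some `p` with nonzero constant term `c`. Then
`c * φ a` is `-μ` times the value of `p.divX` at `μ` times `φ a`, which lies in `φ(M)`. So `A / M`
has finite exponent. -/
theorem relIndex_ne_zero_of_mul_mem [CharZero K] (h : ScalarAction A φ χ)
    (hF : FiniteAbelianTorsionSections G) {μ : K} (hμ0 : μ ≠ 0) {M : Subgroup G} (hMA : M ≤ A)
    (hμ : ∀ a ∈ A, ∃ b ∈ M, φ b = μ * φ a) : M.relIndex A ≠ 0 := by
  by_cases hA : A = ⊥
  · subst hA
    simp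
  have hμA : ∀ a ∈ A, ∃ b ∈ A, φ b = μ * φ a := fun a ha =>
    (hμ a ha).imp fun b hb => ⟨hMA hb.1, hb.2⟩
  obtain ⟨p, hp0, hp⟩ := (h.isAlgebraic_of_mul_mem hF hA hμA).exists_nonzero_coeff_and_aeval_eq_zero
    (mem_nonZeroDivisors_of_ne_zero hμ0)
  have hpow : ∀ a ∈ A, a ^ (p.coeff 0) ∈ M := by
    intro a ha
    obtain ⟨b, hb, hb'⟩ := h.exists_aeval_mul hμA p.divX a ha
    obtain ⟨m, hm, hm'⟩ := hμ b hb
    have h1 : φ (a ^ p.coeff 0) = φ m⁻¹ := by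
      rw [h.map_zpow ha, h.map_inv (hMA hm), hm', hb']
      rw [← Polynomial.divX_mul_X_add p] at hp
      simp only [map_add, _root_.map_mul, Polynomial.aeval_X, eq_intCast, map_intCast] at hp
      linear_combination φ a * hp
    rw [h.inj (zpow_mem ha _) (inv_mem (hMA hm)) h1]
    exact inv_mem hm
  refine hF (p.coeff 0).natAbs (Int.natAbs_pos.2 hp0) M A hMA ?_ ?_
  · intro a ha b hb
    rw [commutatorElement_eq_one_iff_mul_comm.2 (h.comm ha hb)]
    exact one_mem M
  · intro a ha
    rw [← zpow_natCast, Int.natCast_natAbs]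
    rcases abs_choice (p.coeff 0) with h1 | h1 <;> rw [h1]
    · exact hpow a ha
    · rw [zpow_neg]
      exact inv_mem (hpow a ha)

end ScalarAction

/-! ### Near supplements from derivations: the non-integral case -/

/-- `K` is supplemented up to finite index by a polycyclic subgroup. -/
def HasPolycyclicNearSupplement {G : Type*} [Group G] (K : Subgroup G) : Prop :=
  ∃ H : Subgroup G, IsPolycyclic H ∧ (H ⊔ K).FiniteIndex

theorem LinearMap.map_aeval_of_comp_eq {R M N : Type*} [CommRing R] [AddCommGroup M] [Module R M]
    [AddCommGroup N] [Module R N] {f : M →ₗ[R] N} {X : Module.End R M} {Y : Module.End R N}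
    (h : ∀ m, f (X m) = Y (f m)) (p : Polynomial R) :
    ∀ m, f (Polynomial.aeval X p m) = Polynomial.aeval Y p (f m) := by
  induction p using Polynomial.induction_on with
  | C n => intro m; simp
  | add p q hp hq => intro m; simp [hp, hq]
  | monomial n r ih =>
    intro m
    have h1 := ih (X m)
    rw [h] at h1
    simp only [pow_succ, map_mul, map_pow, Polynomial.aeval_X, Module.End.mul_apply] at h1 ⊢
    exact h1

theorem commutatorElement_mem_ker {G M : Type*} [Group G] [CommMonoid M] (χ : G →* M) (g k : G) :
    ⁅g, k⁆ ∈ χ.ker := by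
  rw [MonoidHom.mem_ker, commutatorElement_def, map_mul, map_mul, map_mul, mul_right_comm (χ g),
    ← map_mul, mul_inv_cancel, map_one, one_mul, ← map_mul, mul_inv_cancel, map_one]

namespace ScalarAction

variable {G K : Type*} [Group G] [Field K] {A : Subgroup G} {φ : G → K} {χ : G →* K}

theorem conj_eq_of_mem_ker [A.Normal] (h : ScalarAction A φ χ) {c a : G} (hc : c ∈ χ.ker)
    (ha : a ∈ A) : c * a = a * c := by
  have h1 := h.map_conj c a ha
  rw [MonoidHom.mem_ker.1 hc, one_mul] at h1
  exact mul_inv_eq_iff_eq_mul.1 (h.inj (Subgroup.Normal.conj_mem inferInstance a ha c) ha h1)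

/-- `ker χ` centralizes `A`, so its commutator subgroup meets `A` in a finitely generated group. The
image of that group in `K` is stable under `χ x`, and a nonzero such module would make `χ x`
integral. -/
theorem commutator_ker_inf_eq_bot [A.Normal] (h : ScalarAction A φ χ) (hQ : IsPolycyclic (G ⧸ A))
    {x : G} (hx : ¬ IsIntegral ℤ (χ x)) :
    commutator χ.ker ⊓ A.comap χ.ker.subtype = ⊥ := by
  have hC : IsPolycyclic (χ.ker ⧸ A.comap χ.ker.subtype) :=
    hQ.of_injective _ (QuotientGroup.map_comap_injective χ.ker.subtype A)
  obtain ⟨F, hFA, hF, hle⟩ := exists_fg_of_central (A.comap χ.ker.subtype) (fun a ha => by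
    rw [Subgroup.mem_center_iff]
    exact fun c => Subtype.ext (h.conj_eq_of_mem_ker c.2 ha)) hC
  set I : Subgroup χ.ker := commutator χ.ker ⊓ A.comap χ.ker.subtype
  have hIA : I.map χ.ker.subtype ≤ A := by
    rintro _ ⟨c, hc, rfl⟩
    exact hc.2
  have hFA' : F.map χ.ker.subtype ≤ A := by
    rintro _ ⟨c, hc, rfl⟩
    exact hFA hc
  have hFfg : (F.map χ.ker.subtype).FG := by
    obtain ⟨E, rfl, hE⟩ := (Subgroup.fg_iff F).1 hF
    exact (Subgroup.fg_iff _).2 ⟨_, (MonoidHom.map_closure _ _).symm, hE.image _⟩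
  have hIfg : (h.image _ hIA).FG := by
    refine (h.image_fg hFA' hFfg).of_le ?_
    rintro _ ⟨b, hb, rfl⟩
    exact ⟨b, Subgroup.map_mono hle hb, rfl⟩
  have hbot : h.image _ hIA = ⊥ := by
    by_contra hne
    refine hx (isIntegral_of_smul_mem_submodule (h.image _ hIA) hne hIfg (χ x) ?_)
    rintro _ ⟨_, ⟨c, hc, rfl⟩, rfl⟩
    refine ⟨x * c * x⁻¹, ⟨MulAut.conjNormal x c, ⟨?_, ?_⟩, MulAut.conjNormal_apply x c⟩,
      h.map_conj x c hc.2⟩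
    · have h1 := (Subgroup.characteristic_iff_map_eq.1
        (inferInstance : (commutator χ.ker).Characteristic)) (MulAut.conjNormal x)
      rw [← h1]
      exact ⟨c, hc.1, rfl⟩
    · change (MulAut.conjNormal x c : G) ∈ A
      rw [MulAut.conjNormal_apply]
      exact (inferInstance : A.Normal).conj_mem (c : G) hc.2 x
  rw [eq_bot_iff]
  intro c hc
  have h1 : φ c ∈ h.image _ hIA := ⟨c, ⟨c, hc, rfl⟩, rfl⟩
  rw [hbot, Submodule.mem_bot] at h1
  exact Subtype.ext (h.eq_one _ hc.2 h1)

/-- A derivation on `G` that takes its values in `φ '' A` and is injective on `A` defines a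
near supplement. -/
theorem hasPolycyclicNearSupplement_of_derivation [CharZero K] [A.Normal]
    (h : ScalarAction A φ χ) (hA : A ≠ ⊥) (hF : FiniteAbelianTorsionSections G)
    (hQ : IsPolycyclic (G ⧸ A)) {δ : G → K} (hδ : ∀ g k, δ (g * k) = δ g + χ g * δ k)
    (hδA : ∀ g, ∃ a ∈ A, φ a = δ g) {μ : K} (hμ0 : μ ≠ 0) (hμ : ∀ a ∈ A, δ a = μ * φ a) :
    HasPolycyclicNearSupplement A := by
  have hδ1 : δ 1 = 0 := by
    have := hδ 1 1
    simpa using this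
  have hδinv : ∀ g, χ g * δ g⁻¹ = -δ g := fun g => by
    have := hδ g g⁻¹
    rw [mul_inv_cancel, hδ1] at this
    linear_combination -this
  let H : Subgroup G :=
    { carrier := {g | δ g = 0}
      one_mem' := hδ1
      mul_mem' := fun {g k} (hg : δ g = 0) (hk : δ k = 0) => by
        change δ (g * k) = 0
        rw [hδ, hg, hk, mul_zero, add_zero]
      inv_mem' := fun {g} (hg : δ g = 0) => by
        have h1 := hδinv g
        rw [hg, neg_zero] at h1
        exact (mul_eq_zero.1 h1).resolve_left (chi_ne_zero χ g) }
  refine ⟨H, ?_, ⟨?_⟩⟩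
  · refine hQ.of_injective ((QuotientGroup.mk' A).comp H.subtype)
      ((injective_iff_map_eq_one _).2 fun g hg => ?_)
    have hgA : (g : G) ∈ A := (QuotientGroup.eq_one_iff _).1 hg
    have h1 : μ * φ (g : G) = 0 := (hμ _ hgA).symm.trans g.2
    exact Subtype.ext (h.eq_one _ hgA ((mul_eq_zero.1 h1).resolve_left hμ0))
  -- `M` corresponds to `μ φ(A)`, the set of values of `δ` on `A`.
  · let M : Subgroup G :=
      { carrier := {b | b ∈ A ∧ ∃ a ∈ A, φ b = μ * φ a}
        one_mem' := ⟨one_mem A, 1, one_mem A, by rw [h.map_one, mul_zero]⟩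
        mul_mem' := by
          rintro b c ⟨hb, a, ha, hab⟩ ⟨hc, d, hd, hcd⟩
          exact ⟨mul_mem hb hc, a * d, mul_mem ha hd, by
            rw [h.map_mul _ hb _ hc, h.map_mul _ ha _ hd, hab, hcd, mul_add]⟩
        inv_mem' := by
          rintro b ⟨hb, a, ha, hab⟩
          exact ⟨inv_mem hb, a⁻¹, inv_mem ha, by rw [h.map_inv hb, h.map_inv ha, hab, mul_neg]⟩ }
    have hM : M.relIndex A ≠ 0 := by
      refine h.relIndex_ne_zero_of_mul_mem hF hμ0 (fun b hb => hb.1) fun a ha => ?_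
      obtain ⟨b, hb, hba⟩ := hδA a
      rw [hμ a ha] at hba
      exact ⟨b, ⟨hb, a, ha, hba⟩, hba⟩
    have hfin : Finite (A ⧸ M.subgroupOf A) := Subgroup.index_ne_zero_iff_finite.1 hM
    choose l hlA hl using hδA
    rw [Subgroup.index_ne_zero_iff_finite]
    -- A coset is recovered from the class of `δ` modulo `δ(A)`: if `δ k = δ g + δ a`, then `k` and
    -- `a * g` have the same value under `δ`, so `(a * g)⁻¹ * k ∈ H`.
    refine Finite.of_injective (fun q : G ⧸ (H ⊔ A) =>
      (QuotientGroup.mk ⟨l q.out, hlA q.out⟩ : A ⧸ M.subgroupOf A)) fun q r hqr => ?_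
    obtain ⟨-, a, ha, hla⟩ := Subgroup.mem_subgroupOf.1 (QuotientGroup.eq.1 hqr)
    rw [← QuotientGroup.out_eq' q, ← QuotientGroup.out_eq' r, QuotientGroup.eq]
    set g := q.out
    set k := r.out
    have h1 : δ k - δ g = δ a := by
      have h2 : φ ((l g)⁻¹ * l k) = μ * φ a := hla
      rw [h.map_mul _ (inv_mem (hlA g)) _ (hlA k), h.map_inv (hlA g), hl, hl] at h2
      rw [hμ a ha, ← h2]
      ring
    let b := g⁻¹ * a * g⁻¹⁻¹
    have hb : b ∈ A := Subgroup.Normal.conj_mem inferInstance a ha g⁻¹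
    have h2 : δ (b⁻¹ * (g⁻¹ * k)) = 0 := by
      have h3 : χ g * χ g⁻¹ = 1 := by rw [← _root_.map_mul, mul_inv_cancel, _root_.map_one]
      have h4 : δ b⁻¹ = -(χ g⁻¹ * δ a) := by
        rw [hμ _ (inv_mem hb), h.map_inv hb, h.map_conj _ a ha, hμ a ha]
        ring
      rw [hδ, h4, h.chi_eq_one hA (inv_mem hb), hδ]
      have h5 := hδinv g
      refine mul_left_cancel₀ (chi_ne_zero χ g) ?_
      linear_combination (δ k - δ a) * h3 + h5 + h1
    have h3 : g⁻¹ * k = b * (b⁻¹ * (g⁻¹ * k)) := by group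
    rw [h3]
    exact mul_mem (Subgroup.mem_sup_right hb) (Subgroup.mem_sup_left h2)

/-- Since `A` misses the commutators of `C = ker χ`, it embeds in the abelianization of `C` with
finitely generated cokernel. A monic `p` evaluated at the action of `x` maps the abelianization into
`A`. This gives an equivariant `ρ : C → φ(A)` that multiplies by `p(χ x) ≠ 0` on `A`, and `g ↦ ρ ⁅g,
x⁆` is the required derivation. -/
theorem hasPolycyclicNearSupplement_of_not_isIntegral [CharZero K] [A.Normal]
    (h : ScalarAction A φ χ) (hA : A ≠ ⊥) (hF : FiniteAbelianTorsionSections G)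
    (hQ : IsPolycyclic (G ⧸ A)) {x : G} (hx : ¬ IsIntegral ℤ (χ x)) :
    HasPolycyclicNearSupplement A := by
  have hI := h.commutator_ker_inf_eq_bot hQ hx
  have hAC : A ≤ χ.ker := fun a ha => h.chi_eq_one hA ha
  let e : χ.ker → Additive (Abelianization χ.ker) := fun c => Additive.ofMul (Abelianization.of c)
  have he_mul : ∀ c d, e (c * d) = e c + e d := fun c d => _root_.map_mul Abelianization.of c d
  have he_surj : Function.Surjective e := QuotientGroup.mk_surjective
  let L : G → Module.End ℤ (Additive (Abelianization χ.ker)) := fun g =>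
    (MonoidHom.toAdditive
      (Abelianization.map (MulAut.conjNormal g : MulAut χ.ker).toMonoidHom)).toIntLinearMap
  have hL : ∀ g c, L g (e c) = e (MulAut.conjNormal g c) := fun g c => rfl
  -- `⁅g, k⁆` lies in `ker χ`, so conjugation by it is trivial on the abelianization.
  have hLcomm : ∀ g k z, L g (L k z) = L k (L g z) := by
    intro g k z
    obtain ⟨c, rfl⟩ := he_surj z
    rw [hL, hL, hL, hL]
    have hgk : ⁅g, k⁆ ∈ χ.ker := commutatorElement_mem_ker χ g k
    have h1 : MulAut.conjNormal g (MulAut.conjNormal k c) = ⟨⁅g, k⁆, hgk⟩ *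
        MulAut.conjNormal k (MulAut.conjNormal g c) * (⟨⁅g, k⁆, hgk⟩ : χ.ker)⁻¹ := by
      apply Subtype.ext
      simp only [MulAut.conjNormal_apply, Subgroup.coe_mul, Subgroup.coe_inv,
        commutatorElement_def]
      group
    rw [h1]
    change Abelianization.of _ = Abelianization.of _
    rw [_root_.map_mul, _root_.map_mul, _root_.map_inv, mul_comm, inv_mul_cancel_left]
  let _ : CommGroup A := { (inferInstance : Group A) with
    mul_comm := fun a b => Subtype.ext (h.comm a.2 b.2) }
  let j : Additive A →+ Additive (Abelianization χ.ker) :=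
    MonoidHom.toAdditive (Abelianization.of.comp (Subgroup.inclusion hAC))
  have hj_inj : Function.Injective j := by
    refine (injective_iff_map_eq_zero j).2 fun a ha => ?_
    have h1 : (⟨a.toMul, hAC a.toMul.2⟩ : χ.ker) ∈ commutator χ.ker := by
      rw [← Abelianization.ker_of]
      exact ha
    have h2 : (⟨a.toMul, hAC a.toMul.2⟩ : χ.ker) ∈
        commutator χ.ker ⊓ A.comap χ.ker.subtype := ⟨h1, a.toMul.2⟩
    rw [hI, Subgroup.mem_bot] at h2
    have h3 : (a.toMul : G) = 1 := congrArg Subtype.val h2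
    exact congrArg Additive.ofMul (Subtype.ext h3 : a.toMul = 1)
  -- `π` need not be equivariant; equivariance of `ρ` only uses its values on `P`, the image of `A`,
  -- where it agrees with `φ`.
  obtain ⟨π, hπ⟩ := AddCommGroup.exists_hom_extension j hj_inj h.hom
  let P : Submodule ℤ (Additive (Abelianization χ.ker)) := LinearMap.range j.toIntLinearMap
  have hP : ∀ {z}, z ∈ P ↔ ∃ (a : G) (ha : a ∈ A), e ⟨a, hAC ha⟩ = z :=
    ⟨fun ⟨a, ha⟩ => ⟨a.toMul, a.toMul.2, ha⟩, fun ⟨a, ha, haz⟩ => ⟨Additive.ofMul ⟨a, ha⟩, haz⟩⟩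
  have hπe : ∀ (a : G) (ha : a ∈ A), π (e ⟨a, hAC ha⟩) = φ a := fun a ha => hπ ⟨a, ha⟩
  have hLA : ∀ (g a : G) (ha : a ∈ A), L g (e ⟨a, hAC ha⟩) =
      e ⟨g * a * g⁻¹, hAC (Subgroup.Normal.conj_mem inferInstance a ha g)⟩ := fun g a ha => by
    rw [hL]
    congr 1
  have hLP : P ≤ P.comap (L x) := by
    intro z hz
    obtain ⟨a, ha, rfl⟩ := hP.1 hz
    exact hP.2 ⟨_, Subgroup.Normal.conj_mem inferInstance a ha x, (hLA x a ha).symm⟩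
  have hfin : Module.Finite ℤ (Additive (Abelianization χ.ker) ⧸ P) := by
    have hC : IsPolycyclic (χ.ker ⧸ A.comap χ.ker.subtype) :=
      hQ.of_injective _ (QuotientGroup.map_comap_injective χ.ker.subtype A)
    let q : χ.ker →* Multiplicative (Additive (Abelianization χ.ker) ⧸ P) :=
      { toFun := fun c => Multiplicative.ofAdd (P.mkQ (e c))
        map_one' := map_zero P.mkQ
        map_mul' := fun c d => by rw [he_mul, map_add]; rfl }
    have hq : ∀ c ∈ A.comap χ.ker.subtype, q c = 1 := fun c hc =>
      (Submodule.Quotient.mk_eq_zero P).2 (hP.2 ⟨c, hc, rfl⟩)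
    have hfg := hC.fg
    have : Group.FG (Multiplicative (Additive (Abelianization χ.ker) ⧸ P)) := by
      refine Group.fg_of_surjective (f := QuotientGroup.lift (A.comap χ.ker.subtype) q hq) ?_
      intro z
      obtain ⟨y, hy⟩ := P.mkQ_surjective z.toAdd
      obtain ⟨c, rfl⟩ := he_surj y
      exact ⟨QuotientGroup.mk c, hy⟩
    rw [Module.Finite.iff_addGroup_fg, AddGroup.fg_iff_mul_fg]
    exact this
  obtain ⟨p, hpm, hp⟩ := LinearMap.exists_monic_and_aeval_eq_zero ℤ (P.mapQ P (L x) hLP)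
  have hpP : ∀ z, Polynomial.aeval (L x) p z ∈ P := by
    intro z
    have h1 := LinearMap.map_aeval_of_comp_eq (f := P.mkQ) (X := L x) (Y := P.mapQ P (L x) hLP)
      (fun m => rfl) p z
    rw [hp, LinearMap.zero_apply] at h1
    exact (Submodule.Quotient.mk_eq_zero P).1 h1
  have hpx : Polynomial.aeval (χ x) p ≠ 0 := fun h0 => hx ⟨p, hpm, by
    rwa [Polynomial.aeval_def] at h0⟩
  let ρ : χ.ker → K := fun c => π (Polynomial.aeval (L x) p (e c))
  have hρ_mul : ∀ c d, ρ (c * d) = ρ c + ρ d := fun c d => by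
    simp only [ρ, he_mul, map_add]
  have hρ_mem : ∀ c, ∃ a ∈ A, φ a = ρ c := fun c => by
    obtain ⟨a, ha, haz⟩ := hP.1 (hpP (e c))
    exact ⟨a, ha, by simp only [ρ]; rw [← haz, hπe a ha]⟩
  have hρ_conj : ∀ g c, ρ (MulAut.conjNormal g c) = χ g * ρ c := fun g c => by
    simp only [ρ]
    rw [← hL, ← LinearMap.map_aeval_of_comp_eq (f := L g) (X := L x) (Y := L x)
      (fun m => hLcomm g x m)]
    obtain ⟨a, ha, haz⟩ := hP.1 (hpP (e c))
    rw [← haz, hLA g a ha, hπe _ (Subgroup.Normal.conj_mem inferInstance a ha g), hπe a ha,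
      h.map_conj g a ha]
  have hρA : ∀ (q : Polynomial ℤ) (a : G) (ha : a ∈ A),
      π (Polynomial.aeval (L x) q (e ⟨a, hAC ha⟩)) = Polynomial.aeval (χ x) q * φ a := by
    intro q
    induction q using Polynomial.induction_on with
    | C n => intro a ha; simp [← hπe a ha]
    | add q r hq hr =>
      intro a ha
      rw [map_add, LinearMap.add_apply, map_add, hq a ha, hr a ha, map_add, add_mul]
    | monomial n r ih =>
      intro a ha
      have h1 := ih _ (Subgroup.Normal.conj_mem inferInstance a ha x)
      rw [← hLA x a ha, h.map_conj x a ha] at h1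
      simp only [pow_succ, _root_.map_mul, map_pow, Polynomial.aeval_X,
        Module.End.mul_apply] at h1 ⊢
      rw [h1]
      ring
  have hcx : ∀ g, ⁅g, x⁆ ∈ χ.ker := fun g => commutatorElement_mem_ker χ g x
  refine h.hasPolycyclicNearSupplement_of_derivation hA hF hQ
    (δ := fun g => ρ ⟨⁅g, x⁆, hcx g⟩) ?_ (fun g => hρ_mem _)
    (μ := (1 - χ x) * Polynomial.aeval (χ x) p) ?_ ?_
  · intro g k
    have h1 : (⟨⁅g * k, x⁆, hcx (g * k)⟩ : χ.ker) =
        MulAut.conjNormal g ⟨⁅k, x⁆, hcx k⟩ * ⟨⁅g, x⁆, hcx g⟩ := by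
      apply Subtype.ext
      simp only [MulAut.conjNormal_apply, Subgroup.coe_mul, commutatorElement_def]
      group
    simp only [h1, hρ_mul, hρ_conj]
    ring
  -- `χ x ≠ 1` because `1` is integral.
  · refine mul_ne_zero (sub_ne_zero.2 fun h1 => hx ?_) hpx
    rw [← h1]
    exact isIntegral_one
  · intro a ha
    have hxa := Subgroup.Normal.conj_mem inferInstance a⁻¹ (inv_mem ha) x
    have h1 : ⁅a, x⁆ = a * (x * a⁻¹ * x⁻¹) := by rw [commutatorElement_def]; group
    have h2 : ⁅a, x⁆ ∈ A := h1 ▸ mul_mem ha hxa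
    have h3 := hρA p ⁅a, x⁆ h2
    have h4 : φ ⁅a, x⁆ = (1 - χ x) * φ a := by
      rw [h1, h.map_mul a ha _ hxa, h.map_conj x _ (inv_mem ha), h.map_inv ha]
      ring
    rw [h4] at h3
    simp only [ρ]
    rw [h3]
    ring

end ScalarAction

/-! ### Reductions for near supplements; the torsion case -/

theorem Subgroup.relIndex_sup_of_le {G : Type*} [Group G] (X H K : Subgroup G) [K.Normal]
    (hKX : K ≤ X) : X.relIndex (H ⊔ K) = X.relIndex H := by
  have hX : X = (X.map (QuotientGroup.mk' K)).comap (QuotientGroup.mk' K) := by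
    rw [Subgroup.comap_map_eq, QuotientGroup.ker_mk', sup_eq_left.2 hKX]
  have hK : K.map (QuotientGroup.mk' K) = ⊥ := by
    rw [Subgroup.map_eq_bot_iff, QuotientGroup.ker_mk']
  rw [hX, Subgroup.relIndex_comap, Subgroup.relIndex_comap, Subgroup.map_sup, hK, sup_bot_eq]

theorem IsPolycyclic.subgroupOf_quotient {G : Type*} [Group G] {K : Subgroup G} [K.Normal]
    (h : IsPolycyclic (G ⧸ K)) (H : Subgroup G) : IsPolycyclic (H ⧸ K.subgroupOf H) :=
  h.of_injective _ (QuotientGroup.map_comap_injective H.subtype K)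

theorem IsPolycyclic.map_quotient {G : Type*} [Group G] {K : Subgroup G} [K.Normal]
    (h : IsPolycyclic (G ⧸ K)) (B : Subgroup G) [B.Normal] :
    IsPolycyclic ((G ⧸ B) ⧸ K.map (QuotientGroup.mk' B)) :=
  h.of_surjective (QuotientGroup.map K (K.map (QuotientGroup.mk' B)) (QuotientGroup.mk' B)
      (Subgroup.le_comap_map _ _))
    (QuotientGroup.map_surjective_of_surjective _ _ _
      ((QuotientGroup.mk'_surjective _).comp (QuotientGroup.mk'_surjective B)) _)

theorem IsPolycyclic.exists_fg_supplement {G : Type*} [Group G] {K : Subgroup G} [K.Normal]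
    (h : IsPolycyclic (G ⧸ K)) : ∃ H : Subgroup G, Group.FG H ∧ H ⊔ K = ⊤ := by
  obtain ⟨T, hT, hTfin⟩ := Group.fg_iff.1 h.fg
  choose l hl using QuotientGroup.mk_surjective (s := K)
  refine ⟨Subgroup.closure (l '' T), (Group.fg_iff_subgroup_fg _).2
    ((Subgroup.fg_iff _).2 ⟨_, rfl, hTfin.image l⟩), ?_⟩
  have h1 : (Subgroup.closure (l '' T)).map (QuotientGroup.mk' K) = ⊤ := by
    rw [MonoidHom.map_closure, ← hT, ← Set.image_comp]
    congr 1
    exact (Set.image_congr fun q _ => hl q).trans (Set.image_id T)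
  have h2 := Subgroup.comap_map_eq (QuotientGroup.mk' K) (Subgroup.closure (l '' T))
  rw [h1, Subgroup.comap_top, QuotientGroup.ker_mk'] at h2
  exact h2.symm

namespace HasPolycyclicNearSupplement

theorem of_isPolycyclic {G : Type*} [Group G] (hG : IsPolycyclic G) (K : Subgroup G) :
    HasPolycyclicNearSupplement K :=
  ⟨⊤, hG.subgroup ⊤, by rw [top_sup_eq]; infer_instance⟩

theorem bot {G : Type*} [Group G] {K : Subgroup G} [K.Normal] (hK : K = ⊥)
    (hQ : IsPolycyclic (G ⧸ K)) : HasPolycyclicNearSupplement K := by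
  subst hK
  exact of_isPolycyclic (.of_normal ⊥ (.of_subsingleton _) hQ) ⊥

theorem mono {G : Type*} [Group G] {B K : Subgroup G} (h : HasPolycyclicNearSupplement B)
    (hBK : B ≤ K) : HasPolycyclicNearSupplement K := by
  obtain ⟨H, hH, hfin⟩ := h
  exact ⟨H, hH, Subgroup.finiteIndex_of_le (sup_le_sup_left hBK H)⟩

theorem of_subgroup {G : Type*} [Group G] {K : Subgroup G} [K.Normal] {S : Subgroup G}
    (hS : (S ⊔ K).FiniteIndex) (h : HasPolycyclicNearSupplement (K.subgroupOf S)) :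
    HasPolycyclicNearSupplement K := by
  obtain ⟨H, hH, hfin⟩ := h
  refine ⟨H.map S.subtype, hH.of_surjective _ (S.subtype.subgroupMap_surjective H), ⟨?_⟩⟩
  have h1 : (H.map S.subtype ⊔ K).relIndex S ≠ 0 := by
    refine fun h0 => hfin.index_ne_zero (Nat.eq_zero_of_zero_dvd ?_)
    rw [← h0]
    refine Subgroup.index_dvd_of_le (sup_le ?_ ?_)
    · exact fun x hx => Subgroup.mem_sup_left ⟨x, hx, rfl⟩
    · exact fun x hx => Subgroup.mem_sup_right hx
  rw [← Subgroup.relIndex_sup_of_le _ _ K le_sup_right] at h1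
  rw [← Subgroup.relIndex_top_right] at *
  exact Subgroup.relIndex_ne_zero_trans h1 (by
    rw [Subgroup.relIndex_top_right]
    exact hS.index_ne_zero)

/-- Lift a near supplement of `K / B` to `H'` in `G`; modulo `B` it is polycyclic, so `B ⊓ H'` has a
near supplement in `H'`. As `H'` is only found along the way, `h2` is required for every `H`. -/
theorem trans {G : Type*} [Group G] {B K : Subgroup G} [B.Normal] [K.Normal] (hBK : B ≤ K)
    (h1 : HasPolycyclicNearSupplement (K.map (QuotientGroup.mk' B)))
    (h2 : ∀ H : Subgroup G, IsPolycyclic (H ⧸ B.subgroupOf H) →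
      HasPolycyclicNearSupplement (B.subgroupOf H)) :
    HasPolycyclicNearSupplement K := by
  obtain ⟨H, hH, hfin⟩ := h1
  let H' := H.comap (QuotientGroup.mk' B)
  refine of_subgroup (S := H') ⟨?_⟩ ((h2 H' ?_).mono (Subgroup.comap_mono hBK))
  · have h3 : (H ⊔ K.map (QuotientGroup.mk' B)).comap (QuotientGroup.mk' B) ≤ H' ⊔ K := by
      intro g hg
      obtain ⟨x, hx, _, ⟨k, hk, rfl⟩, hxy⟩ := Subgroup.mem_sup_of_normal_right.1 hg
      obtain ⟨x, rfl⟩ := QuotientGroup.mk'_surjective B x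
      rw [← map_mul] at hxy
      obtain ⟨b, hb, rfl⟩ : ∃ b ∈ B, g = x * k * b := ⟨_, QuotientGroup.eq.1 hxy, by group⟩
      exact mul_mem (mul_mem (Subgroup.mem_sup_left hx) (Subgroup.mem_sup_right hk))
        (Subgroup.mem_sup_right (hBK hb))
    refine fun h0 => hfin.index_ne_zero ?_
    rw [← Subgroup.index_comap_of_surjective _ (QuotientGroup.mk'_surjective B)]
    exact Nat.eq_zero_of_zero_dvd (h0 ▸ Subgroup.index_dvd_of_le h3)
  · refine hH.of_injective ((QuotientGroup.map (B.comap H'.subtype) B H'.subtype le_rfl).codRestrict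
      H fun q => ?_) fun q r hqr => QuotientGroup.map_comap_injective H'.subtype B
        (congrArg Subtype.val hqr)
    induction q using QuotientGroup.induction_on with
    | H x => exact x.2

theorem of_torsion {G : Type*} [Group G] {A : Subgroup G} [A.Normal]
    (hc : ∀ a ∈ A, ∀ b ∈ A, a * b = b * a) (htor : ∀ a ∈ A, ∃ n : ℕ, 0 < n ∧ a ^ n = 1)
    (hF : FiniteAbelianTorsionSections G) (hQ : IsPolycyclic (G ⧸ A)) :
    HasPolycyclicNearSupplement A := by
  obtain ⟨S, hSfg, hS⟩ := hQ.exists_fg_supplement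
  refine of_subgroup (S := S) (by rw [hS]; infer_instance) (of_isPolycyclic ?_ _)
  have hSQ := hQ.subgroupOf_quotient S
  have hAc : ∀ a ∈ A.subgroupOf S, ∀ b ∈ A.subgroupOf S, a * b = b * a := fun a ha b hb =>
    Subtype.ext (hc a ha b hb)
  obtain ⟨E, hE, hEA⟩ := hSQ.ker_isFinitelyNormallyGenerated hSfg
    (QuotientGroup.mk' (A.subgroupOf S)) (QuotientGroup.mk'_surjective _)
  rw [QuotientGroup.ker_mk'] at hEA
  have hEA' : ∀ e ∈ E, e ∈ A.subgroupOf S := fun e he => hEA ▸ Subgroup.subset_normalClosure he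
  choose! o ho hoe using htor
  -- A common exponent for the finitely many normal generators. The elements of `A.subgroupOf S`
  -- killed by `n` form a normal subgroup, hence `n` kills all of it.
  let n := ∏ e ∈ hE.toFinset, o e
  have hn : 0 < n := Finset.prod_pos fun e he => ho e (hEA' e (hE.mem_toFinset.1 he))
  let N : Subgroup S :=
    { carrier := {a | a ∈ A.subgroupOf S ∧ a ^ n = 1}
      one_mem' := ⟨one_mem _, one_pow n⟩
      mul_mem' := fun {a b} ha hb => ⟨mul_mem ha.1 hb.1, by
        rw [Commute.mul_pow (hAc a ha.1 b hb.1), ha.2, hb.2, one_mul]⟩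
      inv_mem' := fun {a} ha => ⟨inv_mem ha.1, by rw [inv_pow, ha.2, inv_one]⟩ }
  have hN : N.Normal := by
    refine ⟨fun a ha g => ⟨Subgroup.Normal.conj_mem inferInstance a ha.1 g, ?_⟩⟩
    rw [conj_pow, ha.2, mul_one, mul_inv_cancel]
  have hle : A.subgroupOf S ≤ N := by
    conv_lhs => rw [← hEA]
    refine Subgroup.normalClosure_le_normal fun e he => ⟨hEA' e he, ?_⟩
    obtain ⟨d, hd⟩ := Finset.dvd_prod_of_mem (fun e : S => o e) (hE.mem_toFinset.2 he)
    have h1 : e ^ o e = 1 := Subtype.ext (hoe e (hEA' e he))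
    change e ^ n = 1
    rw [show n = o e * d from hd, pow_mul, h1, one_pow]
  have hfin := hF.subgroup S n hn ⊥ (A.subgroupOf S) bot_le
    (fun a ha b hb => by
      rw [commutatorElement_eq_one_iff_mul_comm.2 (hAc a ha b hb)]
      exact one_mem _)
    (fun a ha => by rw [(hle ha).2]; exact one_mem _)
  rw [Subgroup.relIndex_bot_left] at hfin
  have : Finite (A.subgroupOf S) := Nat.finite_of_card_ne_zero hfin
  exact .of_normal (A.subgroupOf S)
    (.of_comm_fg (fun a b => Subtype.ext (hAc a a.2 b b.2)) inferInstance) hSQ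

theorem of_scalarAction {G K : Type*} [Group G] [Field K] [CharZero K] {A : Subgroup G} [A.Normal]
    {φ : G → K} {χ : G →* K} (h : ScalarAction A φ χ) (hF : FiniteAbelianTorsionSections G)
    (hQ : IsPolycyclic (G ⧸ A)) : HasPolycyclicNearSupplement A := by
  obtain ⟨S, hSfg, hS⟩ := hQ.exists_fg_supplement
  refine of_subgroup (S := S) (by rw [hS]; infer_instance) ?_
  have hSQ := hQ.subgroupOf_quotient S
  have h' : ScalarAction (A.subgroupOf S) (fun g : S => φ g) (χ.comp S.subtype) :=
    { map_mul := fun a ha b hb => h.map_mul a ha b hb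
      eq_one := fun a ha h0 => Subtype.ext (h.eq_one a ha h0)
      map_conj := fun g a ha => h.map_conj g a ha }
  by_cases hA : A.subgroupOf S = ⊥
  · exact bot hA hSQ
  by_cases hint : ∀ g, IsIntegral ℤ (χ.comp S.subtype g)
  · exact of_isPolycyclic (h'.isPolycyclic_of_isIntegral hSfg hSQ hint) _
  · push Not at hint
    obtain ⟨x, hx⟩ := hint
    exact h'.hasPolycyclicNearSupplement_of_not_isIntegral hA (hF.subgroup S) hSQ hx

end HasPolycyclicNearSupplement

/-! ### The torsion-free case by semi-invariant homomorphisms -/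

/-- `G` acts by conjugation on the homomorphisms from a normal subgroup to `K`. -/
def conjHomRep {G : Type*} [Group G] (A : Subgroup G) [A.Normal] (K : Type*) [Field K] :
    G →* ((Additive A →+ K) →ₗ[K] (Additive A →+ K)) where
  toFun g :=
    { toFun := fun φ => φ.comp (MonoidHom.toAdditive (MulAut.conjNormal g⁻¹ : MulAut A).toMonoidHom)
      map_add' := fun _ _ => rfl
      map_smul' := fun _ _ => rfl }
  map_one' := by
    refine LinearMap.ext fun φ => AddMonoidHom.ext fun a => ?_
    change φ (Additive.ofMul (MulAut.conjNormal (1 : G)⁻¹ a.toMul)) = φ a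
    rw [inv_one, map_one]
    rfl
  map_mul' g h := by
    refine LinearMap.ext fun φ => AddMonoidHom.ext fun a => ?_
    change φ (Additive.ofMul (MulAut.conjNormal (g * h)⁻¹ a.toMul)) =
      φ (Additive.ofMul (MulAut.conjNormal h⁻¹ (MulAut.conjNormal g⁻¹ a.toMul)))
    rw [mul_inv_rev, map_mul]
    rfl

theorem conjHomRep_apply {G : Type*} [Group G] (A : Subgroup G) [A.Normal] (K : Type*) [Field K]
    (g : G) (φ : Additive A →+ K) (a : A) :
    conjHomRep A K g φ (Additive.ofMul a) = φ (Additive.ofMul (MulAut.conjNormal g⁻¹ a)) := rfl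

/-- A common eigenvector in the space of homomorphisms from `A` to an algebraically closed field. -/
theorem exists_semiinvariant_hom {G : Type*} [Group G] {A : Subgroup G} [A.Normal]
    (hc : ∀ a ∈ A, ∀ b ∈ A, a * b = b * a) (hF : FiniteAbelianTorsionSections G)
    (hQ : IsPolycyclic (G ⧸ A)) (K : Type*) [Field K] [IsAlgClosed K] [CharZero K]
    [Nontrivial (Additive A →+ K)] :
    ∃ φ : Additive A →+ K, φ ≠ 0 ∧ ∃ S : Subgroup G, S.FiniteIndex ∧ A ≤ S ∧
      ∃ χ : S →* K, ∀ (g : S) (a : A),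
        φ (Additive.ofMul (MulAut.conjNormal (g : G) a)) = χ g * φ (Additive.ofMul a) := by
  let _ : CommGroup A := { (inferInstance : Group A) with
    mul_comm := fun a b => Subtype.ext (hc a a.2 b b.2) }
  have hfd : FiniteDimensional K (Additive A →+ K) := (hF.subgroup A).finiteDimensional_hom K
  have hA : ∀ g ∈ A, conjHomRep A K g = 1 := by
    intro g hg
    refine LinearMap.ext fun φ => AddMonoidHom.ext fun a => ?_
    change φ (Additive.ofMul (MulAut.conjNormal g⁻¹ a.toMul)) = φ a
    have : MulAut.conjNormal g⁻¹ a.toMul = a.toMul := by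
      apply Subtype.ext
      rw [MulAut.conjNormal_apply, hc g⁻¹ (inv_mem hg) _ a.toMul.2, mul_inv_cancel_right]
    rw [this]
    rfl
  obtain ⟨φ, hφ, hfin⟩ := hQ.exists_common_eigenvector
    (QuotientGroup.lift A (conjHomRep A K) hA)
  refine ⟨φ, hφ, lineStabilizer (conjHomRep A K) φ, ⟨?_⟩, ?_, ?_⟩
  · have h1 : lineStabilizer (conjHomRep A K) φ =
        (lineStabilizer (QuotientGroup.lift A (conjHomRep A K) hA) φ).comap
          (QuotientGroup.mk' A) := rfl
    rw [h1, Subgroup.index_comap_of_surjective _ (QuotientGroup.mk'_surjective A)]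
    exact hfin.index_ne_zero
  · intro g hg
    exact ⟨1, one_ne_zero, by rw [hA g hg, one_smul]; rfl⟩
  · obtain ⟨a, ha⟩ : ∃ a, φ a ≠ 0 := by
      by_contra! h
      exact hφ (AddMonoidHom.ext h)
    have hex : ∀ g : lineStabilizer (conjHomRep A K) φ, ∃ c : K, ∀ a : A,
        φ (Additive.ofMul (MulAut.conjNormal (g : G) a)) = c * φ (Additive.ofMul a) := by
      intro g
      -- The representation precomposes with conjugation by the inverse, so the scalar for `g` is
      -- the eigenvalue of `g⁻¹`.
      obtain ⟨c, _, hcg⟩ := inv_mem g.2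
      refine ⟨c, fun a => ?_⟩
      have h1 := DFunLike.congr_fun hcg (Additive.ofMul a)
      rw [conjHomRep_apply, inv_inv] at h1
      exact h1
    choose c hcg using hex
    refine ⟨⟨⟨c, ?_⟩, fun g h => ?_⟩, hcg⟩
    · have h1 := hcg 1 a.toMul
      rw [Subgroup.coe_one, map_one] at h1
      exact (mul_right_cancel₀ ha ((one_mul _).trans h1)).symm
    · have h1 := hcg (g * h) a.toMul
      rw [Subgroup.coe_mul, map_mul] at h1
      have h2 := hcg g (MulAut.conjNormal (h : G) a.toMul)
      rw [hcg h, ← mul_assoc] at h2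
      exact mul_right_cancel₀ ha (h1.symm.trans h2)

namespace HasPolycyclicNearSupplement

/-- The quotient of `A` by the kernel of a semi-invariant homomorphism. -/
theorem map_ker_of_semiinvariant {G K : Type*} [Group G] [Field K] [CharZero K] {A B : Subgroup G}
    [A.Normal] [B.Normal] (hc : ∀ a ∈ A, ∀ b ∈ A, a * b = b * a)
    (hF : FiniteAbelianTorsionSections G) (hQ : IsPolycyclic (G ⧸ A)) {φ : G → K} {χ : G →* K}
    (hφ : ∀ a ∈ A, ∀ b ∈ A, φ (a * b) = φ a + φ b)
    (hχ : ∀ g, ∀ a ∈ A, φ (g * a * g⁻¹) = χ g * φ a)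
    (hB : ∀ b, b ∈ B ↔ b ∈ A ∧ φ b = 0) (hne : ∃ a ∈ A, φ a ≠ 0) :
    HasPolycyclicNearSupplement (A.map (QuotientGroup.mk' B)) := by
  obtain ⟨a₀, ha₀, hφ₀⟩ := hne
  have hχB : ∀ b ∈ B, χ b = 1 := by
    intro b hb
    have h1 := hχ b a₀ ha₀
    rw [hc b ((hB b).1 hb).1 a₀ ha₀, mul_inv_cancel_right] at h1
    exact (mul_right_cancel₀ hφ₀ ((one_mul _).trans h1)).symm
  -- On `A / B` the chosen representative does not matter, because `φ` vanishes on `B`; values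
  -- elsewhere play no role.
  let ψ : G ⧸ B → K := fun q => φ q.out
  have hψ : ∀ a ∈ A, ψ (QuotientGroup.mk' B a) = φ a := by
    intro a ha
    obtain ⟨b, hb⟩ := QuotientGroup.mk_out_eq_mul B a
    have hbB := (hB b).1 b.2
    change φ (Quotient.out (QuotientGroup.mk a : G ⧸ B)) = φ a
    rw [hb, hφ a ha _ hbB.1, hbB.2, add_zero]
  refine of_scalarAction (φ := ψ) (χ := QuotientGroup.lift B χ hχB) ?_ (hF.quotient B)
    (hQ.map_quotient B)
  refine ⟨?_, ?_, ?_⟩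
  · rintro _ ⟨a, ha, rfl⟩ _ ⟨b, hb, rfl⟩
    rw [← map_mul, hψ _ (mul_mem ha hb), hψ a ha, hψ b hb, hφ a ha b hb]
  · rintro _ ⟨a, ha, rfl⟩ h0
    rw [hψ a ha] at h0
    exact (QuotientGroup.eq_one_iff a).2 ((hB a).2 ⟨ha, h0⟩)
  · rintro g _ ⟨a, ha, rfl⟩
    obtain ⟨g, rfl⟩ := QuotientGroup.mk'_surjective B g
    rw [← map_mul, ← map_inv, ← map_mul, hψ _ (Subgroup.Normal.conj_mem inferInstance a ha g),
      hψ a ha, hχ g a ha]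
    rfl

/-- Induction on the dimension of `Hom(A, ℂ)`. For the kernel `B` of a semi-invariant `φ ≠ 0`,
restriction of homomorphisms from `A` to subgroups of `B` is onto because `ℂ` is divisible, and it
kills `φ`, so the dimension drops. -/
theorem of_torsionFree {G : Type*} [Group G] {A : Subgroup G} [A.Normal]
    (hc : ∀ a ∈ A, ∀ b ∈ A, a * b = b * a) (htf : ∀ a ∈ A, a ≠ 1 → ∀ n : ℤ, a ^ n = 1 → n = 0)
    (hF : FiniteAbelianTorsionSections G) (hQ : IsPolycyclic (G ⧸ A)) :
    HasPolycyclicNearSupplement A := by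
  induction hn : Module.finrank ℂ (Additive A →+ ℂ) using Nat.strong_induction_on generalizing G
    with
  | _ n ih =>
  by_cases hA : A = ⊥
  · exact bot hA hQ
  let _ : CommGroup A := { (inferInstance : Group A) with
    mul_comm := fun a b => Subtype.ext (hc a a.2 b b.2) }
  have hfd : FiniteDimensional ℂ (Additive A →+ ℂ) := (hF.subgroup A).finiteDimensional_hom ℂ
  obtain ⟨a₁, ha₁⟩ := Subgroup.ne_bot_iff_exists_ne_one.1 hA
  have : Nontrivial (Additive A →+ ℂ) := nontrivial_hom_of_torsionFree (a := a₁) (fun n hn =>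
    htf a₁ a₁.2 (fun h => ha₁ (Subtype.ext h)) n (congrArg Subtype.val hn)) ℂ
  obtain ⟨φ, hφ, S, hS, hAS, χ, hχ⟩ := exists_semiinvariant_hom hc hF hQ ℂ
  have hSQ := hQ.subgroupOf_quotient S
  have hSF := hF.subgroup S
  refine of_subgroup (S := S) (Subgroup.finiteIndex_of_le le_sup_left) ?_
  classical
  let ψ : S → ℂ := fun g => if hg : (g : G) ∈ A then φ (Additive.ofMul ⟨g, hg⟩) else 0
  have hψ : ∀ (g : S) (hg : (g : G) ∈ A), ψ g = φ (Additive.ofMul ⟨g, hg⟩) :=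
    fun g hg => dif_pos hg
  have hψ_mul : ∀ a ∈ A.subgroupOf S, ∀ b ∈ A.subgroupOf S, ψ (a * b) = ψ a + ψ b := by
    intro a ha b hb
    rw [hψ a ha, hψ b hb, hψ (a * b) (mul_mem ha hb), ← map_add]
    rfl
  have hψ_one : ψ 1 = 0 := by
    have := hψ_mul 1 (one_mem _) 1 (one_mem _)
    simpa using this
  have hψ_conj : ∀ g, ∀ a ∈ A.subgroupOf S, ψ (g * a * g⁻¹) = χ g * ψ a := by
    intro g a ha
    rw [hψ a ha, ← hχ, hψ _ (Subgroup.Normal.conj_mem inferInstance (a : G) ha (g : G))]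
    congr 2
  let B : Subgroup S :=
    { carrier := {b | b ∈ A.subgroupOf S ∧ ψ b = 0}
      one_mem' := ⟨one_mem _, hψ_one⟩
      mul_mem' := fun {a b} ha hb => ⟨mul_mem ha.1 hb.1, by
        rw [hψ_mul a ha.1 b hb.1, ha.2, hb.2, add_zero]⟩
      inv_mem' := fun {a} ha => ⟨inv_mem ha.1, by
        have h1 := hψ_mul a⁻¹ (inv_mem ha.1) a ha.1
        rw [inv_mul_cancel, hψ_one, ha.2, add_zero] at h1
        exact h1.symm⟩ }
  have hBn : B.Normal := by
    refine ⟨fun b hb g => ⟨Subgroup.Normal.conj_mem inferInstance b hb.1 g, ?_⟩⟩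
    rw [hψ_conj g b hb.1, hb.2, mul_zero]
  have hBA : B ≤ A.subgroupOf S := fun b hb => hb.1
  have hAc : ∀ a ∈ A.subgroupOf S, ∀ b ∈ A.subgroupOf S, a * b = b * a := fun a ha b hb =>
    Subtype.ext (hc a ha b hb)
  refine trans hBA ?_ fun H hH => ?_
  · obtain ⟨a, ha⟩ : ∃ a, φ a ≠ 0 := by
      by_contra! h
      exact hφ (AddMonoidHom.ext h)
    refine map_ker_of_semiinvariant hAc hSF hSQ hψ_mul hψ_conj (fun b => Iff.rfl)
      ⟨⟨a.toMul, hAS a.toMul.2⟩, a.toMul.2, ?_⟩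
    rw [hψ _ a.toMul.2]
    exact ha
  · have hBc : ∀ a ∈ B.subgroupOf H, ∀ b ∈ B.subgroupOf H, a * b = b * a := fun a ha b hb =>
      Subtype.ext (hAc a (hBA ha) b (hBA hb))
    refine ih _ ?_ hBc ?_ (hSF.subgroup H) hH rfl
    · let _ : CommGroup (B.subgroupOf H) := { (inferInstance : Group (B.subgroupOf H)) with
        mul_comm := fun a b => Subtype.ext (hBc a a.2 b b.2) }
      let ι : Additive (B.subgroupOf H) →+ Additive A := MonoidHom.toAdditive
        { toFun := fun b => (⟨((b : H) : S), hBA b.2⟩ : A)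
          map_one' := rfl
          map_mul' := fun _ _ => rfl }
      have hι : Function.Injective ι := by
        intro a b hab
        exact Subtype.ext (Subtype.ext (Subtype.ext (congrArg (fun z : A => (z : G)) hab)))
      let r : (Additive A →+ ℂ) →ₗ[ℂ] (Additive (B.subgroupOf H) →+ ℂ) :=
        { toFun := fun f => f.comp ι
          map_add' := fun _ _ => rfl
          map_smul' := fun _ _ => rfl }
      have hr : Function.Surjective r := fun f => by
        obtain ⟨g, hg⟩ := AddCommGroup.exists_hom_extension ι hι f
        exact ⟨g, AddMonoidHom.ext hg⟩
      have hrφ : φ ∈ LinearMap.ker r := by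
        rw [LinearMap.mem_ker]
        refine AddMonoidHom.ext fun b => ?_
        have h1 : ψ ((b.toMul : H) : S) = 0 := (b.toMul.2 : ((b.toMul : H) : S) ∈ B).2
        exact (hψ ((b.toMul : H) : S) (hBA b.toMul.2)).symm.trans h1
      have hpos : 0 < Module.finrank ℂ (LinearMap.ker r) :=
        Module.finrank_pos_iff_exists_ne_zero.2
          ⟨⟨φ, hrφ⟩, fun h => hφ (congrArg Subtype.val h)⟩
      have h1 := r.finrank_range_add_finrank_ker
      rw [LinearMap.range_eq_top.2 hr, finrank_top] at h1
      omega
    · intro a ha ha1 n hn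
      refine htf a.1.1 (hBA ha) (fun h => ha1 (Subtype.ext (Subtype.ext h))) n ?_
      exact congrArg (fun z : H => ((z : S) : G)) hn

/-! ### From abelian to solvable to minimax -/

theorem of_abelian {G : Type*} [Group G] {A : Subgroup G} [A.Normal]
    (hc : ∀ a ∈ A, ∀ b ∈ A, a * b = b * a) (hF : FiniteAbelianTorsionSections G)
    (hQ : IsPolycyclic (G ⧸ A)) : HasPolycyclicNearSupplement A := by
  let T : Subgroup G :=
    { carrier := {a | a ∈ A ∧ ∃ n : ℕ, 0 < n ∧ a ^ n = 1}
      one_mem' := ⟨one_mem A, 1, one_pos, one_pow 1⟩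
      mul_mem' := by
        rintro a b ⟨ha, n, hn, han⟩ ⟨hb, m, hm, hbm⟩
        refine ⟨mul_mem ha hb, n * m, Nat.mul_pos hn hm, ?_⟩
        rw [Commute.mul_pow (hc a ha b hb), pow_mul, han, one_pow, mul_comm n m, pow_mul, hbm,
          one_pow, one_mul]
      inv_mem' := by
        rintro a ⟨ha, n, hn, han⟩
        exact ⟨inv_mem ha, n, hn, by rw [inv_pow, han, inv_one]⟩ }
  have hT : T.Normal := by
    refine ⟨fun a ⟨ha, n, hn, han⟩ g =>
      ⟨Subgroup.Normal.conj_mem inferInstance a ha g, n, hn, ?_⟩⟩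
    rw [conj_pow, han, mul_one, mul_inv_cancel]
  have hTA : T ≤ A := fun a ha => ha.1
  refine trans hTA (of_torsionFree ?_ ?_ (hF.quotient T) (hQ.map_quotient T)) fun H hH =>
    of_torsion (fun a ha b hb => Subtype.ext (hc a (hTA ha) b (hTA hb))) ?_ (hF.subgroup H) hH
  · rintro _ ⟨a, ha, rfl⟩ _ ⟨b, hb, rfl⟩
    rw [← map_mul, ← map_mul, hc a ha b hb]
  · rintro _ ⟨a, ha, rfl⟩ ha1 n hn
    by_contra hn0
    refine ha1 ((QuotientGroup.eq_one_iff a).2 ?_)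
    rw [← map_zpow] at hn
    obtain ⟨-, m, hm, ham⟩ : a ^ n ∈ T := (QuotientGroup.eq_one_iff _).1 hn
    refine ⟨ha, n.natAbs * m, Nat.mul_pos (Int.natAbs_pos.2 hn0) hm, ?_⟩
    rw [← zpow_natCast, ← zpow_mul] at ham
    rw [← zpow_natCast, Nat.cast_mul, Int.natCast_natAbs]
    rcases abs_choice n with h | h <;> rw [h]
    · exact ham
    · rw [neg_mul, zpow_neg, ham, inv_one]
  · rintro a ⟨_, n, hn, han⟩
    exact ⟨n, hn, Subtype.ext han⟩

theorem of_solvable {G : Type*} [Group G] {K : Subgroup G} [K.Normal] {n : ℕ}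
    (hK : derivedSeries K n = ⊥) (hF : FiniteAbelianTorsionSections G)
    (hQ : IsPolycyclic (G ⧸ K)) : HasPolycyclicNearSupplement K := by
  induction n generalizing G with
  | zero =>
    refine bot ?_ hQ
    rw [derivedSeries_zero] at hK
    rw [eq_bot_iff]
    intro x hx
    have : (⟨x, hx⟩ : K) ∈ (⊥ : Subgroup K) := hK ▸ Subgroup.mem_top _
    exact congrArg Subtype.val (Subgroup.mem_bot.1 this)
  | succ n ih =>
    -- The last derived term is abelian, and `K / B` has derived length at most `n`.
    let B : Subgroup G := (derivedSeries K n).map K.subtype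
    have hBn : B.Normal := inferInstance
    have hBK : B ≤ K := Subgroup.map_subtype_le _
    refine trans hBK (ih ?_ (hF.quotient B) (hQ.map_quotient B)) fun H hH =>
      of_abelian ?_ (hF.subgroup H) hH
    · rw [← map_derivedSeries_eq ((QuotientGroup.mk' B).subgroupMap_surjective K),
        Subgroup.map_eq_bot_iff]
      intro x hx
      exact Subtype.ext ((QuotientGroup.eq_one_iff _).2 ⟨x, hx, rfl⟩)
    · rintro a ⟨x, hx, hxa⟩ b ⟨y, hy, hyb⟩
      have h1 : ⁅x, y⁆ ∈ derivedSeries K (n + 1) := Subgroup.commutator_mem_commutator hx hy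
      rw [hK, Subgroup.mem_bot, commutatorElement_eq_one_iff_mul_comm] at h1
      have h2 : (x : G) * y = y * x := congrArg Subtype.val h1
      refine Subtype.ext ?_
      change (x : G) = a at hxa
      change (y : G) = b at hyb
      rw [Subgroup.coe_mul, Subgroup.coe_mul, ← hxa, ← hyb, h2]

end HasPolycyclicNearSupplement

theorem IsMinimax.hasPolycyclicNearSupplement {G : Type*} [Group G] (hG : IsMinimax G)
    {K : Subgroup G} [K.Normal] (hK : IsPolycyclic (G ⧸ K)) : HasPolycyclicNearSupplement K := by
  obtain ⟨S, hS, hSf⟩ := hG.exists_solvable_finiteIndex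
  refine .of_subgroup (S := S) (Subgroup.finiteIndex_of_le le_sup_left) ?_
  obtain ⟨n, hn⟩ := (inferInstance : Group.IsSolvable (K.subgroupOf S)).solvable
  exact .of_solvable hn (hG.finiteAbelianTorsionSections.subgroup S) (hK.subgroupOf_quotient S)

theorem mainTheorem6 (G : Type*) [Group G] (hG : IsMinimax G)
    (K : Subgroup G) [K.Normal] (hK : IsPolycyclic (G ⧸ K)) :
    ∃ H : Subgroup G, IsPolycyclic H ∧
      ∃ L : Subgroup G, (L : Set G) = {g : G | ∃ h ∈ H, ∃ k ∈ K, g = h * k} ∧ L.FiniteIndex := by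
  obtain ⟨H, hH, hfin⟩ := hG.hasPolycyclicNearSupplement hK
  refine ⟨H, hH, H ⊔ K, ?_, hfin⟩
  ext g
  rw [SetLike.mem_coe, Subgroup.mem_sup_of_normal_right]
  exact ⟨fun ⟨h, hh, k, hk, e⟩ => ⟨h, hh, k, hk, e.symm⟩,
    fun ⟨h, hh, k, hk, e⟩ => ⟨h, hh, k, hk, e.symm⟩⟩
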